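/- Let $(\mathcal V,g)$ be a smooth 4-dimensional Lorentzian manifold of signature $(-,+,+,+)$ with Levi-Civita connection $\nabla$ and curvature $R(X,Y)Z=\nabla_X\nabla_YZ-\nabla_Y\nabla_XZ-\nabla_{[X,Y]}Z$, and write $R(M,N,X,Y)=g(M,R(X,Y)N)$. Let $\Phi:S\to\mathcal V$ be a smooth immersion of a smooth (Hausdorff) 2-dimensional manifold with $\Phi^*g$ positive definite (a spacelike surface). Let $\mathfrak X(S)$ and $\mathfrak X(S)^\perp$ be the smooth tangent and normal vector fields of $S$, and let $T$ and $\perp$ denote tangential and normal parts. For $N\in\mathfrak X(S)^\perp$ and $X,Y\in\mathfrak X(S)$ put $A_N(X)=(\nabla_XN)^T$, $D_XN=(\nabla_XN)^\perp$ and $R^\perp(X,Y)N=D_XD_YN-D_YD_XN-D_{[X,Y]}N$. A point $x\in S$ is umbilical with respect to $N$ if $A_N|_x=\tfrac12F\,\mathbf 1$ for some $F\in\mathbb R$, umbilical along a normal direction if this holds for some $N\in\mathfrak X(S)^\perp$ with $N|_x\neq0$, and totally umbilical if it holds for all $N\in\mathfrak X(S)^\perp$. For a smooth frame $(u,n)$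 of the normal bundle over an open subset of $S$ with $-g(u,u)=g(n,n)=1$, $g(u,n)=0$, let $\epsilon^\perp$ be the volume form of the normal planes with $\epsilon^\perp(u,n)=1$, let $\star^\perp N=(i_N\epsilon^\perp)^\sharp$ (so $\star^\perp u=n$, $\star^\perp n=u$), let $s(X)=g(D_Xu,n)$, and let $ds(X,Y)=X(s(Y))-Y(s(X))-s([X,Y])$. (a) For every $x\in S$ the following are equivalent: (1) $S$ is umbilical at $x$ along a normal direction; (2) $R^\perp(X,Y)N=(R(X,Y)N)^\perp$ at $x$ for all $X,Y\in\mathfrak X(S)$, $N\in\mathfrak X(S)^\perp$; (3) for every such frame $(u,n)$ defined around $x$, $R(M,N,X,Y)=ds(X,Y)\,g(\star^\perp N,M)$ at $x$ for all $X,Y\in\mathfrak X(S)$, $M,N\in\mathfrak X(S)^\perp$; (4) for some such frame defined around $x$, the identity in (3) holds at $x$ for all $X,Y,M,N$. (b) Consequently, $S$ is umbilical along a normal direction at each of its points if and only if $R^\perp(X,Y)N=(R(X,Y)N)^\perp$ on $S$ for all $X,Y\in\mathfrak X(S)$, $N\in\mathfrak X(S)^\perp$, and if and only if $R(M,N,X,Y)=ds(X,Y)\,g(\star^\perp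 N,M)$ for all $X,Y\in\mathfrak X(S)$, $M,N\in\mathfrak X(S)^\perp$, on the domain of every such frame. (c) If $x\in S$ is not totally umbilical, then (2) holds at all points of a neighbourhood of $x$ if and only if there is $N\in\mathfrak X(S)^\perp$ with $N|_x\neq0$ such that all points of a neighbourhood of $x$ are umbilical with respect to $N$. -/

import Mathlib

open scoped Manifold ContDiff Topology

noncomputable section

/-- Model space of spacetime. -/
abbrev E4 : Type := EuclideanSpace ℝ (Fin 4)

/-- Model space of surfaces. -/
abbrev E2 : Type := EuclideanSpace ℝ (Fin 2)

/-- A smooth Lorentzian metric, of signature (-,+,+,+), on a 4-dimensional manifold: a smooth field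
of symmetric bilinear forms which at every point have a timelike vector on whose orthogonal
complement they are positive definite. -/
structure LorentzMetric (V : Type*) [TopologicalSpace V] [ChartedSpace E4 V]
    [IsManifold (𝓡 4) ∞ V] where
  val (p : V) : TangentSpace (𝓡 4) p →L[ℝ] TangentSpace (𝓡 4) p →L[ℝ] ℝ
  symm (p : V) (v w : TangentSpace (𝓡 4) p) : val p v w = val p w v
  signature (p : V) : ∃ t : TangentSpace (𝓡 4) p, val p t t < 0 ∧
    ∀ v : TangentSpace (𝓡 4) p, val p t v = 0 → v ≠ 0 → 0 < val p v v
  contMDiff : ContMDiff (𝓡 4) ((𝓡 4).prod 𝓘(ℝ, E4 →L[ℝ] E4 →L[ℝ] ℝ)) ∞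
    (fun p ↦ Bundle.TotalSpace.mk' (E4 →L[ℝ] E4 →L[ℝ] ℝ)
      (E := fun p : V ↦ TangentSpace (𝓡 4) p →L[ℝ] TangentSpace (𝓡 4) p →L[ℝ] ℝ) p (val p))

namespace LorentzMetric

variable {V : Type*} [TopologicalSpace V] [ChartedSpace E4 V] [IsManifold (𝓡 4) ∞ V]
variable (g : LorentzMetric V)

/-- The musical isomorphism `♯` at `p`: the inverse of `v ↦ g(v, ·)`. -/
def sharp (p : V) (α : TangentSpace (𝓡 4) p →L[ℝ] ℝ) : TangentSpace (𝓡 4) p :=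
  (g.val p).inverse α

/-! ### The Levi-Civita connection

A tangent vector at `p` is, in Mathlib, identified with its components in the preferred chart at
`p`. All derivatives at `p` below are taken in that chart (equivalently, in the trivialization of
the tangent bundle that it induces, which is the identity over `p` itself). -/

/-- The components of the metric in the preferred chart at `p`, as functions of the point `q`. -/
def coords (p q : V) : E4 →L[ℝ] E4 →L[ℝ] ℝ :=
  (trivializationAt (E4 →L[ℝ] E4 →L[ℝ] ℝ)
    (fun r : V ↦ TangentSpace (𝓡 4) r →L[ℝ] TangentSpace (𝓡 4) r →L[ℝ] ℝ) p ⟨q, g.val q⟩).2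

/-- Their first derivatives at `p`: `dcoords p a v w = ∂_a g(v, w)`. -/
def dcoords (p : V) : E4 →L[ℝ] E4 →L[ℝ] E4 →L[ℝ] ℝ :=
  mvfderiv (𝓡 4) (g.coords p) p

/-- Christoffel symbols of the second kind at `p`:
`g(Γ(v, w), a) = (∂_v g(w, a) + ∂_w g(v, a) - ∂_a g(v, w)) / 2`. -/
def christoffel (p : V) (v w : TangentSpace (𝓡 4) p) : TangentSpace (𝓡 4) p :=
  g.sharp p ((1 / 2 : ℝ) •
    (g.dcoords p v w + g.dcoords p w v - ((g.dcoords p).flip v).flip w : E4 →L[ℝ] ℝ))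

/-- The derivative `∂_v Z` at `p` of the components, in the preferred chart at `p`, of a vector
field `Z` on `V`. -/
def partialDeriv (Z : ∀ p : V, TangentSpace (𝓡 4) p) (p : V) (v : TangentSpace (𝓡 4) p) :
    TangentSpace (𝓡 4) p :=
  mvfderiv (𝓡 4) (fun q : V ↦ (trivializationAt E4 (TangentSpace (𝓡 4)) p ⟨q, Z q⟩).2) p v

/-- The Levi-Civita connection: `(∇_v Z)(p) = ∂_v Z + Γ(v, Z)` for a vector field `Z` on `V`. -/
def nabla (Z : ∀ p : V, TangentSpace (𝓡 4) p) (p : V) (v : TangentSpace (𝓡 4) p) :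
    TangentSpace (𝓡 4) p :=
  partialDeriv Z p v + g.christoffel p v (Z p)

/-- `R(X,Y)Z = ∇_X ∇_Y Z - ∇_Y ∇_X Z - ∇_[X,Y] Z` for vector fields on `V`. -/
def curvatureField (X Y Z : ∀ p : V, TangentSpace (𝓡 4) p) (p : V) : TangentSpace (𝓡 4) p :=
  g.nabla (fun q ↦ g.nabla Z q (Y q)) p (X p) - g.nabla (fun q ↦ g.nabla Z q (X q)) p (Y p)
    - g.nabla Z p (VectorField.mlieBracket (𝓡 4) X Y p)

/-- The Riemann tensor `R(v,w)z` at `p`: as `R` is tensorial, it may be evaluated on any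
extensions of the three vectors to vector fields smooth near `p`. -/
def riemann (p : V) (v w z : TangentSpace (𝓡 4) p) : TangentSpace (𝓡 4) p :=
  g.curvatureField (FiberBundle.extend E4 v) (FiberBundle.extend E4 w) (FiberBundle.extend E4 z) p

end LorentzMetric

/-! ### Surfaces -/

section Surface

variable {V : Type*} [TopologicalSpace V] [ChartedSpace E4 V] [IsManifold (𝓡 4) ∞ V]
variable {S : Type*} [TopologicalSpace S] [ChartedSpace E2 S] [IsManifold (𝓡 2) ∞ S]

/-- The differential of `Φ` at `x`. -/
def diff (Φ : S → V) (x : S) : TangentSpace (𝓡 2) x →L[ℝ] TangentSpace (𝓡 4) (Φ x) :=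
  mfderiv (𝓡 2) (𝓡 4) Φ x

/-- `Φ` is a smooth map whose first fundamental form `Φ^* g` is positive definite; in particular
its differential is injective, so that `Φ` is an immersion. -/
structure IsSpacelikeImmersion (g : LorentzMetric V) (Φ : S → V) : Prop where
  contMDiff : ContMDiff (𝓡 2) (𝓡 4) ∞ Φ
  spacelike (x : S) (v : TangentSpace (𝓡 2) x) : v ≠ 0 → 0 < g.val (Φ x) (diff Φ x v) (diff Φ x v)

/-- Smooth vector fields on `S`. -/
def IsTangentField (X : ∀ x : S, TangentSpace (𝓡 2) x) : Prop :=
  ContMDiff (𝓡 2) (𝓡 2).tangent ∞ (fun x ↦ (⟨x, X x⟩ : TangentBundle (𝓡 2) S))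

/-- A vector `ξ` of the ambient space at `Φ x` is orthogonal to the surface. -/
def IsNormalVector (g : LorentzMetric V) (Φ : S → V) (x : S) (ξ : TangentSpace (𝓡 4) (Φ x)) : Prop :=
  ∀ v : TangentSpace (𝓡 2) x, g.val (Φ x) ξ (diff Φ x v) = 0

/-- Smooth normal vector fields on the subset `U` of `S` (vector fields along `Φ`). -/
structure IsNormalFieldOn (g : LorentzMetric V) (Φ : S → V) (U : Set S)
    (N : ∀ x : S, TangentSpace (𝓡 4) (Φ x)) : Prop where
  contMDiffOn : ContMDiffOn (𝓡 2) (𝓡 4).tangent ∞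
    (fun x ↦ (⟨Φ x, N x⟩ : TangentBundle (𝓡 4) V)) U
  normal : ∀ x ∈ U, IsNormalVector g Φ x (N x)

/-- Smooth normal vector fields on `S`. -/
def IsNormalField (g : LorentzMetric V) (Φ : S → V) (N : ∀ x : S, TangentSpace (𝓡 4) (Φ x)) :
    Prop :=
  IsNormalFieldOn g Φ Set.univ N

/-- The first fundamental form at `x`. -/
def firstForm (g : LorentzMetric V) (Φ : S → V) (x : S) :
    TangentSpace (𝓡 2) x →L[ℝ] TangentSpace (𝓡 2) x →L[ℝ] ℝ :=
  (ContinuousLinearMap.precomp ℝ (diff Φ x)).comp ((g.val (Φ x)).comp (diff Φ x))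

/-- The tangential part of `ξ`, as a vector tangent to `S`: the `w` with
`Φ^* g(w, v) = g(ξ, dΦ v)` for all `v`. -/
def tangentPart (g : LorentzMetric V) (Φ : S → V) (x : S) (ξ : TangentSpace (𝓡 4) (Φ x)) :
    TangentSpace (𝓡 2) x :=
  (firstForm g Φ x).inverse ((g.val (Φ x) ξ).comp (diff Φ x))

/-- The normal part of `ξ`. -/
def normalPart (g : LorentzMetric V) (Φ : S → V) (x : S) (ξ : TangentSpace (𝓡 4) (Φ x)) :
    TangentSpace (𝓡 4) (Φ x) :=
  ξ - diff Φ x (tangentPart g Φ x ξ)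

/-- The derivative `∂_v Z` at `x` of the components, in the preferred chart of `V` at `Φ x`, of a
vector field `Z` along `Φ`. -/
def partialDerivAlong (Φ : S → V) (Z : ∀ x : S, TangentSpace (𝓡 4) (Φ x)) (x : S)
    (v : TangentSpace (𝓡 2) x) : TangentSpace (𝓡 4) (Φ x) :=
  mvfderiv (𝓡 2)
    (fun y : S ↦ (trivializationAt E4 (TangentSpace (𝓡 4)) (Φ x) ⟨Φ y, Z y⟩).2) x v

/-- The Levi-Civita connection of `V` on vector fields along `Φ` (the pullback connection):
`(∇_v Z)(x) = ∂_v Z + Γ(dΦ v, Z)`, in the preferred chart of `V` at `Φ x`. -/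
def nablaAlong (g : LorentzMetric V) (Φ : S → V) (Z : ∀ x : S, TangentSpace (𝓡 4) (Φ x)) (x : S)
    (v : TangentSpace (𝓡 2) x) : TangentSpace (𝓡 4) (Φ x) :=
  partialDerivAlong Φ Z x v + g.christoffel (Φ x) (diff Φ x v) (Z x)

/-- The Weingarten operator `A_N(v) = (∇_v N)^T`. -/
def weingarten (g : LorentzMetric V) (Φ : S → V) (N : ∀ x : S, TangentSpace (𝓡 4) (Φ x)) (x : S)
    (v : TangentSpace (𝓡 2) x) : TangentSpace (𝓡 2) x :=
  tangentPart g Φ x (nablaAlong g Φ N x v)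

/-- The normal connection `D_v N = (∇_v N)^⊥`. -/
def normalConnection (g : LorentzMetric V) (Φ : S → V) (N : ∀ x : S, TangentSpace (𝓡 4) (Φ x))
    (x : S) (v : TangentSpace (𝓡 2) x) : TangentSpace (𝓡 4) (Φ x) :=
  normalPart g Φ x (nablaAlong g Φ N x v)

/-- The normal curvature `R^⊥(X,Y)N = D_X D_Y N - D_Y D_X N - D_[X,Y] N`. -/
def normalCurvature (g : LorentzMetric V) (Φ : S → V) (X Y : ∀ x : S, TangentSpace (𝓡 2) x)
    (N : ∀ x : S, TangentSpace (𝓡 4) (Φ x)) (x : S) : TangentSpace (𝓡 4) (Φ x) :=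
  normalConnection g Φ (fun y ↦ normalConnection g Φ N y (Y y)) x (X x)
    - normalConnection g Φ (fun y ↦ normalConnection g Φ N y (X y)) x (Y x)
    - normalConnection g Φ N x (VectorField.mlieBracket (𝓡 2) X Y x)

/-- The point `x` is umbilical with respect to `N`: the Weingarten operator `A_N` is proportional
to the identity at `x`. -/
def UmbilicalAt (g : LorentzMetric V) (Φ : S → V) (N : ∀ x : S, TangentSpace (𝓡 4) (Φ x))
    (x : S) : Prop :=
  ∃ F : ℝ, ∀ v : TangentSpace (𝓡 2) x, weingarten g Φ N x v = ((1 / 2) * F) • v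

/-- The surface is umbilical at `x` along a (nonzero) normal direction. -/
def UmbilicalAlongNormalAt (g : LorentzMetric V) (Φ : S → V) (x : S) : Prop :=
  ∃ N : ∀ x : S, TangentSpace (𝓡 4) (Φ x), IsNormalField g Φ N ∧ N x ≠ 0 ∧ UmbilicalAt g Φ N x

/-- The surface is totally umbilical at `x`. -/
def TotallyUmbilicalAt (g : LorentzMetric V) (Φ : S → V) (x : S) : Prop :=
  ∀ N : ∀ x : S, TangentSpace (𝓡 4) (Φ x), IsNormalField g Φ N → UmbilicalAt g Φ N x

/-- At `x`, the normal curvature equals the normal part of the ambient curvature: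
`R^⊥(X,Y)N = (R(X,Y)N)^⊥`. -/
def NormalCurvatureEqAt (g : LorentzMetric V) (Φ : S → V) (x : S) : Prop :=
  ∀ (X Y : ∀ x : S, TangentSpace (𝓡 2) x) (N : ∀ x : S, TangentSpace (𝓡 4) (Φ x)),
    IsTangentField X → IsTangentField Y → IsNormalField g Φ N →
    normalCurvature g Φ X Y N x =
      normalPart g Φ x (g.riemann (Φ x) (diff Φ x (X x)) (diff Φ x (Y x)) (N x))

/-- A smooth orthonormal frame `(u, n)` of the normal bundle over an open set `dom` of `S`, with
`-g(u,u) = g(n,n) = 1` and `g(u,n) = 0`. The normal bundle over `dom` is oriented by it. -/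
structure NormalFrame (g : LorentzMetric V) (Φ : S → V) where
  dom : Set S
  isOpen : IsOpen dom
  u : ∀ x : S, TangentSpace (𝓡 4) (Φ x)
  n : ∀ x : S, TangentSpace (𝓡 4) (Φ x)
  normal_u : IsNormalFieldOn g Φ dom u
  normal_n : IsNormalFieldOn g Φ dom n
  uu : ∀ x ∈ dom, g.val (Φ x) (u x) (u x) = -1
  nn : ∀ x ∈ dom, g.val (Φ x) (n x) (n x) = 1
  un : ∀ x ∈ dom, g.val (Φ x) (u x) (n x) = 0

namespace NormalFrame

variable {g : LorentzMetric V} {Φ : S → V} (F : NormalFrame g Φ)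

/-- The contraction `i_N ε^⊥` of a vector `N` at `Φ x` with the volume 2-form
`ε^⊥ = - u^♭ ∧ n^♭` of the oriented normal plane (`ε^⊥(u, n) = 1`). -/
def contractVolume (x : S) (N : TangentSpace (𝓡 4) (Φ x)) : TangentSpace (𝓡 4) (Φ x) →L[ℝ] ℝ :=
  (g.val (Φ x) (F.n x) N) • g.val (Φ x) (F.u x) - (g.val (Φ x) (F.u x) N) • g.val (Φ x) (F.n x)

/-- The Hodge dual `⋆^⊥ N = (i_N ε^⊥)^♯`; thus `⋆^⊥ u = n` and `⋆^⊥ n = u`. -/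
def star (x : S) (N : TangentSpace (𝓡 4) (Φ x)) : TangentSpace (𝓡 4) (Φ x) :=
  g.sharp (Φ x) (F.contractVolume x N)

/-- The normal connection one-form `s(v) = g(D_v u, n)`. -/
def s (x : S) (v : TangentSpace (𝓡 2) x) : ℝ :=
  g.val (Φ x) (normalConnection g Φ F.u x v) (F.n x)

/-- Its exterior derivative, `ds(X,Y) = X(s(Y)) - Y(s(X)) - s([X,Y])`. -/
def ds (X Y : ∀ x : S, TangentSpace (𝓡 2) x) (x : S) : ℝ :=
  mvfderiv (𝓡 2) (fun y ↦ F.s y (Y y)) x (X x) - mvfderiv (𝓡 2) (fun y ↦ F.s y (X y)) x (Y x)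
    - F.s x (VectorField.mlieBracket (𝓡 2) X Y x)

/-- At `x`, `R(M,N,X,Y) = ds(X,Y) g(⋆^⊥ N, M)`, where `R(M,N,X,Y) = g(M, R(X,Y)N)`. -/
def CurvatureEqAt (x : S) : Prop :=
  ∀ (X Y : ∀ x : S, TangentSpace (𝓡 2) x) (M N : ∀ x : S, TangentSpace (𝓡 4) (Φ x)),
    IsTangentField X → IsTangentField Y → IsNormalField g Φ M → IsNormalField g Φ N →
    g.val (Φ x) (M x) (g.riemann (Φ x) (diff Φ x (X x)) (diff Φ x (Y x)) (N x)) =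
      F.ds X Y x * g.val (Φ x) (F.star x (N x)) (M x)

end NormalFrame

end Surface

end

/-! ### Differential calculus of vector-valued functions and Lie brackets on a manifold. -/

section ManifoldCalculus

variable {m : ℕ} {M : Type*} [TopologicalSpace M] [ChartedSpace (EuclideanSpace ℝ (Fin m)) M]
variable {F G H : Type*} [NormedAddCommGroup F] [NormedSpace ℝ F] [NormedAddCommGroup G]
  [NormedSpace ℝ G] [NormedAddCommGroup H] [NormedSpace ℝ H]

/-! All the conditions say that the Weingarten operators at `x` commute, in the form h(A_N v, A_M w)
= h(A_N w, A_M v) with h the first fundamental form (`WeinComm`). The link to curvature is the Ricci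
equation `form_norCurv`: g(R^⊥(X,Y)N, M) - g(R(X,Y)N, M) = h(A_N Y, A_M X) - h(A_N X, A_M Y). This
gives `normalCurvatureEqAt_iff`.

For a frame (u, n), the normal group SO(1,1) is abelian, so ds(X,Y) = g(R^⊥(X,Y)u, n) (`ds_eq`). The
ambient curvature is skew in two normal arguments and the normal plane has dimension two, so it is
g(R(X,Y)u, n) times g(⋆N, M) (`form_riemannInChart`). The frame identity therefore says that
g(R^⊥(X,Y)u, n) = g(R(X,Y)u, n), that is, that A_u and A_n commute (`curvatureEqAt_iff`).

Umbilicity is linear algebra. The map N ↦ A_N is linear in the value of N at the point, and each A_N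
is self-adjoint on a Euclidean plane. If a nonzero combination of A_u and A_n is scalar, the two
commute. Conversely, let A_N be non-scalar at `x`, with a nonzero off-diagonal entry in an
orthogonal frame. For M independent of N, combine M and N so that the off-diagonal entry cancels:
the new operator is diagonal, and commuting with a non-diagonal one makes it scalar. The combination
has smooth coefficients, so the same construction yields the local statement
(`exists_umbilical_normalField`).

The connection is defined with the preferred chart at each point, a chart that changes with the
point. The analytic work is to show that any chart gives the same result (`toChart_covAlong`, from
`christoffelOf_change`). Smoothness, metricity, vanishing torsion and tensoriality of the curvature
can then be computed in one fixed chart. -/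

theorem mvfderiv_comp_fderiv {k : M → F} {h : F → G} {y : M} (hh : DifferentiableAt ℝ h (k y))
    (hk : MDifferentiableAt (𝓡 m) 𝓘(ℝ, F) k y) (v : TangentSpace (𝓡 m) y) :
    mvfderiv (𝓡 m) (fun z ↦ h (k z)) y v = fderiv ℝ h (k y) (mvfderiv (𝓡 m) k y v) := by
  have := mfderiv_comp_apply (I := 𝓡 m) (I' := 𝓘(ℝ, F)) (I'' := 𝓘(ℝ, G)) y
    hh.mdifferentiableAt hk v
  rw [mfderiv_eq_fderiv] at this
  exact this

theorem mvfderiv_congr {h k : M → F} {y : M} (e : h =ᶠ[𝓝 y] k) (v : TangentSpace (𝓡 m) y) :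
    mvfderiv (𝓡 m) h y v = mvfderiv (𝓡 m) k y v := by
  have := e.mfderiv_eq (I := 𝓡 m) (I' := 𝓘(ℝ, F))
  exact congrArg (fun L : EuclideanSpace ℝ (Fin m) →L[ℝ] F ↦ L v) this

theorem mvfderiv_bilinear (B : F →L[ℝ] G →L[ℝ] H) {a : M → F} {b : M → G} {y : M}
    (ha : MDifferentiableAt (𝓡 m) 𝓘(ℝ, F) a y) (hb : MDifferentiableAt (𝓡 m) 𝓘(ℝ, G) b y)
    (v : TangentSpace (𝓡 m) y) :
    mvfderiv (𝓡 m) (fun z ↦ B (a z) (b z)) y v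
      = B (mvfderiv (𝓡 m) a y v) (b y) + B (a y) (mvfderiv (𝓡 m) b y v) := by
  have h : HasMFDerivAt (𝓡 m) 𝓘(ℝ, H) (fun z ↦ B (a z) (b z)) y
      (B.precompR (EuclideanSpace ℝ (Fin m)) (a y) (mvfderiv (𝓡 m) b y)
        + B.precompL (EuclideanSpace ℝ (Fin m)) (mvfderiv (𝓡 m) a y) (b y)) := by
    refine ⟨((B.continuous.continuousAt.comp ha.continuousAt)).clm_apply hb.continuousAt, ?_⟩
    have h := B.hasFDerivWithinAt_of_bilinear ha.hasMFDerivAt.2 hb.hasMFDerivAt.2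
    simp only [writtenInExtChartAt, Function.comp_apply, extChartAt_to_inv] at h
    exact h
  have := congrArg (fun L : EuclideanSpace ℝ (Fin m) →L[ℝ] H ↦ L v) h.mfderiv
  refine Eq.trans this ?_
  rw [add_comm]
  rfl

theorem mdifferentiableAt_of_contMDiffOn {N : Type*} {E' H' : Type*} [NormedAddCommGroup E']
    [NormedSpace ℝ E'] [TopologicalSpace H'] {I' : ModelWithCorners ℝ E' H'} [TopologicalSpace N]
    [ChartedSpace H' N] {U : Set M} (hU : IsOpen U) {h : M → N}
    (hh : ContMDiffOn (𝓡 m) I' ∞ h U) {x : M} (hx : x ∈ U) : MDifferentiableAt (𝓡 m) I' h x :=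
  (hh.contMDiffAt (hU.mem_nhds hx)).mdifferentiableAt (by simp)

variable [IsManifold (𝓡 m) ∞ M]

/-- Smooth vector fields on a subset. -/
def SmoothOn (U : Set M) (X : ∀ y : M, TangentSpace (𝓡 m) y) : Prop :=
  ContMDiffOn (𝓡 m) (𝓡 m).tangent ∞ (fun y ↦ (⟨y, X y⟩ : TangentBundle (𝓡 m) M)) U

/-- `mvfderiv` at `y` refers to the preferred chart at `y`. Passing to the fixed chart at `x`
exposes the dependence on `y`, so that the derivative can be differentiated again. -/
theorem mvfderiv_eq_fderiv_extChartAt {h : M → F} {x y : M}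
    (hy : y ∈ (extChartAt (𝓡 m) x).source) (hh : MDifferentiableAt (𝓡 m) 𝓘(ℝ, F) h y)
    (v : TangentSpace (𝓡 m) y) :
    mvfderiv (𝓡 m) h y v = fderiv ℝ (h ∘ (extChartAt (𝓡 m) x).symm) (extChartAt (𝓡 m) x y)
      (mvfderiv (𝓡 m) (extChartAt (𝓡 m) x) y v) := by
  have hy' : y ∈ (chartAt (EuclideanSpace ℝ (Fin m)) x).source := by simpa using hy
  have := IsManifold.of_le (I := 𝓡 m) (M := M) (m := 1) (n := ∞) (by simp)
  have h1 : DifferentiableAt ℝ (h ∘ (extChartAt (𝓡 m) x).symm) (extChartAt (𝓡 m) x y) := by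
    have h2 := mdifferentiableWithinAt_extChartAt_symm (I := 𝓡 m) ((extChartAt (𝓡 m) x).map_source hy)
    rw [ModelWithCorners.Boundaryless.range_eq_univ, mdifferentiableWithinAt_univ] at h2
    rw [← mdifferentiableAt_iff_differentiableAt]
    refine MDifferentiableAt.comp _ ?_ h2
    rwa [(extChartAt (𝓡 m) x).left_inv hy]
  rw [← mvfderiv_comp_fderiv h1 (mdifferentiableAt_extChartAt hy')]
  apply mvfderiv_congr
  filter_upwards [extChartAt_source_mem_nhds' hy] with z hz
  simp only [Function.comp_apply, (extChartAt (𝓡 m) x).left_inv hz]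

theorem ContMDiffOn.tangentMap_apply {N : Type*} {E' H' : Type*} [NormedAddCommGroup E']
    [NormedSpace ℝ E'] [TopologicalSpace H'] {I' : ModelWithCorners ℝ E' H'} [TopologicalSpace N]
    [ChartedSpace H' N] [IsManifold I' ∞ N] {U : Set M} (hU : IsOpen U) {h : M → N}
    (hh : ContMDiffOn (𝓡 m) I' ∞ h U) {X : ∀ y : M, TangentSpace (𝓡 m) y}
    (hX : SmoothOn U X) :
    ContMDiffOn (𝓡 m) I'.tangent ∞
      (fun y ↦ (⟨h y, mfderiv (𝓡 m) I' h y (X y)⟩ : TangentBundle I' N)) U := by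
  have := IsManifold.of_le (I := 𝓡 m) (M := M) (m := 1) (n := ∞) (by simp)
  have := IsManifold.of_le (I := I') (M := N) (m := 1) (n := ∞) (by simp)
  have h1 := ContMDiffOn.contMDiffOn_tangentMapWithin (m := ∞) hh (by simp) hU.uniqueMDiffOn
  have h2 := h1.comp hX (fun y hy ↦ by simpa using hy)
  refine h2.congr fun y hy ↦ ?_
  simp [tangentMapWithin, mfderivWithin_of_isOpen hU hy]

theorem contMDiffOn_mvfderiv_apply {U : Set M} (hU : IsOpen U) {h : M → F}
    (hh : ContMDiffOn (𝓡 m) 𝓘(ℝ, F) ∞ h U) {X : ∀ y : M, TangentSpace (𝓡 m) y}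
    (hX : SmoothOn U X) :
    ContMDiffOn (𝓡 m) 𝓘(ℝ, F) ∞ (fun y ↦ mvfderiv (𝓡 m) h y (X y)) U :=
  (contMDiff_snd_tangentBundle_modelSpace F 𝓘(ℝ, F)).comp_contMDiffOn
    (hh.tangentMap_apply hU hX)

/-- In the chart at `x`, differentiating the two first derivatives produces the Hessian of `h`,
which cancels by symmetry; the remaining terms form the coordinate Lie bracket. -/
theorem mvfderiv_mlieBracket {U : Set M} (hU : IsOpen U) {h : M → F}
    (hh : ContMDiffOn (𝓡 m) 𝓘(ℝ, F) ∞ h U) {X Y : ∀ y : M, TangentSpace (𝓡 m) y}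
    (hX : SmoothOn U X) (hY : SmoothOn U Y) {x : M} (hx : x ∈ U) :
    mvfderiv (𝓡 m) h x (VectorField.mlieBracket (𝓡 m) X Y x)
      = mvfderiv (𝓡 m) (fun y ↦ mvfderiv (𝓡 m) h y (Y y)) x (X x)
        - mvfderiv (𝓡 m) (fun y ↦ mvfderiv (𝓡 m) h y (X y)) x (Y x) := by
  have := IsManifold.of_le (I := 𝓡 m) (M := M) (m := 1) (n := ∞) (by simp)
  have := IsManifold.of_le (I := 𝓡 m) (M := M) (m := 2) (n := ∞) ENat.LEInfty.out
  set e := extChartAt (𝓡 m) x with he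
  let P (X : ∀ y : M, TangentSpace (𝓡 m) y) : EuclideanSpace ℝ (Fin m) → EuclideanSpace ℝ (Fin m) :=
    VectorField.mpullbackWithin 𝓘(ℝ, EuclideanSpace ℝ (Fin m)) (𝓡 m) e.symm X (Set.range (𝓡 m))
  have hP (X) (hX : SmoothOn U X) : DifferentiableAt ℝ (P X) (e x) := by
    have h1 : MDifferentiableAt (𝓡 m) (𝓡 m).tangent
      (fun y ↦ (⟨y, X y⟩ : TangentBundle (𝓡 m) M)) x := mdifferentiableAt_of_contMDiffOn hU hX hx
    rw [← mdifferentiableWithinAt_univ] at h1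
    have := h1.differentiableWithinAt_mpullbackWithin_vectorField
    have h2 : DifferentiableWithinAt ℝ (P X) (e.symm ⁻¹' Set.univ ∩ Set.range (𝓡 m)) (e x) := this
    rw [ModelWithCorners.Boundaryless.range_eq_univ, Set.preimage_univ, Set.inter_univ] at h2
    exact differentiableWithinAt_univ.1 h2
  have hPe (X : ∀ y : M, TangentSpace (𝓡 m) y) (y) (hy : y ∈ e.source) :
      P X (e y) = mvfderiv (𝓡 m) e y (X y) := by
    have h1 := mfderivWithin_extChartAt_symm_comp_mfderiv_extChartAt (e.map_source hy)
    have h2 := mfderiv_extChartAt_comp_mfderivWithin_extChartAt_symm (e.map_source hy)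
    have h3 := ContinuousLinearMap.inverse_eq h1 h2
    -- `X (e.symm (e y))` and `X y` live in different tangent spaces, so the equality of base points
    -- is transported through a general `z`.
    have h4 : ∀ z, z = y → mvfderiv (𝓡 m) e z (X z) = mvfderiv (𝓡 m) e y (X y) := by
      rintro z rfl; rfl
    rw [← h4 _ (e.left_inv hy)]
    exact congrArg (fun L : EuclideanSpace ℝ (Fin m) →L[ℝ] EuclideanSpace ℝ (Fin m) ↦
      L (X (e.symm (e y)))) h3
  have hs : ContDiffAt ℝ ∞ (h ∘ e.symm) (e x) := by
    rw [← contMDiffAt_iff_contDiffAt]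
    have h1 := contMDiffOn_extChartAt_symm (I := 𝓡 m) (n := ∞) x
    have h2 := h1.contMDiffAt (extChartAt_target_mem_nhds (I := 𝓡 m) x)
    refine ContMDiffAt.comp (e x) ?_ h2
    rw [extChartAt_to_inv]
    exact hh.contMDiffAt (hU.mem_nhds hx)
  have hD (X) (hX : SmoothOn U X) :
    ∀ v, mvfderiv (𝓡 m) (fun y ↦ mvfderiv (𝓡 m) h y (X y)) x v
      = fderiv ℝ (fderiv ℝ (h ∘ e.symm)) (e x) (mvfderiv (𝓡 m) e x v) (P X (e x))
        + fderiv ℝ (h ∘ e.symm) (e x) (fderiv ℝ (P X) (e x) (mvfderiv (𝓡 m) e x v)) := by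
    intro v
    have h1 : (fun y ↦ mvfderiv (𝓡 m) h y (X y)) =ᶠ[𝓝 x]
        fun y ↦ (fun a ↦ fderiv ℝ (h ∘ e.symm) a (P X a)) (e y) := by
      filter_upwards [extChartAt_source_mem_nhds (I := 𝓡 m) x, hU.mem_nhds hx] with y hy hyU
      rw [hPe X y hy,
        mvfderiv_eq_fderiv_extChartAt hy (mdifferentiableAt_of_contMDiffOn hU hh hyU)]
    have h2 : DifferentiableAt ℝ (fderiv ℝ (h ∘ e.symm)) (e x) :=
      (hs.fderiv_right (m := 1) (by rw [one_add_one_eq_two]; exact ENat.LEInfty.out)).differentiableAt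
        (by simp)
    rw [mvfderiv_congr h1, mvfderiv_comp_fderiv (h2.clm_apply (hP X hX))
      (mdifferentiableAt_extChartAt (mem_chart_source _ x)), fderiv_clm_apply h2 (hP X hX)]
    simp [add_comm]
  rw [hD X hX, hD Y hY, ← hPe X x (mem_extChartAt_source x), ← hPe Y x (mem_extChartAt_source x),
    mvfderiv_eq_fderiv_extChartAt (mem_extChartAt_source x) (mdifferentiableAt_of_contMDiffOn hU hh hx)]
  -- `mlieBracket` is the flat bracket pulled back by the inverse of the chart's differential;
  -- applying that differential recovers the flat bracket.
  have hbr : mvfderiv (𝓡 m) e x (VectorField.mlieBracket (𝓡 m) X Y x) =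
      fderiv ℝ (P Y) (e x) (P X (e x)) - fderiv ℝ (P X) (e x) (P Y (e x)) := by
    have h1 : mvfderiv (𝓡 m) e x (VectorField.mlieBracket (𝓡 m) X Y x) =
        VectorField.lieBracketWithin ℝ (P X) (P Y)
          (e.symm ⁻¹' Set.univ ∩ Set.range (𝓡 m)) (e x) :=
      (isInvertible_mfderiv_extChartAt (mem_extChartAt_source (I := 𝓡 m) x)).self_apply_inverse
        (VectorField.lieBracketWithin (E := EuclideanSpace ℝ (Fin m)) ℝ (P X) (P Y)
          (e.symm ⁻¹' Set.univ ∩ Set.range (𝓡 m)) (e x))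
    rw [h1, ModelWithCorners.Boundaryless.range_eq_univ, Set.preimage_univ, Set.inter_univ,
      VectorField.lieBracketWithin_univ]
    rfl
  rw [hbr]
  have hsym := hs.isSymmSndFDerivAt (by simpa using ENat.LEInfty.out)
  have := hsym (P X (e x)) (P Y (e x))
  rw [map_sub, this]
  abel

omit [IsManifold (𝓡 m) ∞ M]

variable (m) in
/-- The differential of a vector-valued function, in the preferred charts. -/
noncomputable def dfun (h : M → F) (y : M) : EuclideanSpace ℝ (Fin m) →L[ℝ] F :=
  mvfderiv (𝓡 m) h y

variable (m) in
/-- The Lie bracket of vector fields, given by their components in the preferred charts. -/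
noncomputable def bracket (X Y : M → EuclideanSpace ℝ (Fin m)) (y : M) :
    EuclideanSpace ℝ (Fin m) :=
  VectorField.mlieBracket (𝓡 m) X Y y

/-- The `dfun` versions of the rules above have the fixed model space in place of the tangent
spaces, which keeps dependent types out of rewriting. -/
theorem dfun_comp {k : M → F} {h : F → G} {y : M} (hh : DifferentiableAt ℝ h (k y))
    (hk : MDifferentiableAt (𝓡 m) 𝓘(ℝ, F) k y) (v : EuclideanSpace ℝ (Fin m)) :
    dfun m (fun z ↦ h (k z)) y v = fderiv ℝ h (k y) (dfun m k y v) :=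
  mvfderiv_comp_fderiv hh hk v

theorem dfun_congr {h k : M → F} {y : M} (e : h =ᶠ[𝓝 y] k) : dfun m h y = dfun m k y :=
  ContinuousLinearMap.ext fun v ↦ mvfderiv_congr e v

theorem dfun_bilinear (B : F →L[ℝ] G →L[ℝ] H) {a : M → F} {b : M → G} {y : M}
    (ha : MDifferentiableAt (𝓡 m) 𝓘(ℝ, F) a y) (hb : MDifferentiableAt (𝓡 m) 𝓘(ℝ, G) b y)
    (v : EuclideanSpace ℝ (Fin m)) :
    dfun m (fun z ↦ B (a z) (b z)) y v = B (dfun m a y v) (b y) + B (a y) (dfun m b y v) :=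
  mvfderiv_bilinear B ha hb v

theorem dfun_clm_apply {a : M → F →L[ℝ] G} {b : M → F} {y : M}
    (ha : MDifferentiableAt (𝓡 m) 𝓘(ℝ, F →L[ℝ] G) a y)
    (hb : MDifferentiableAt (𝓡 m) 𝓘(ℝ, F) b y) (v : EuclideanSpace ℝ (Fin m)) :
    dfun m (fun z ↦ a z (b z)) y v = dfun m a y v (b y) + a y (dfun m b y v) :=
  dfun_bilinear (ContinuousLinearMap.id ℝ (F →L[ℝ] G)) ha hb v

theorem dfun_add {a b : M → F} {y : M}
    (ha : MDifferentiableAt (𝓡 m) 𝓘(ℝ, F) a y) (hb : MDifferentiableAt (𝓡 m) 𝓘(ℝ, F) b y)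
    (v : EuclideanSpace ℝ (Fin m)) :
    dfun m (fun z ↦ a z + b z) y v = dfun m a y v + dfun m b y v :=
  congrArg (fun L : EuclideanSpace ℝ (Fin m) →L[ℝ] F ↦ L v) (mvfderiv_fun_add ha hb)

theorem dfun_sub {a b : M → F} {y : M}
    (ha : MDifferentiableAt (𝓡 m) 𝓘(ℝ, F) a y) (hb : MDifferentiableAt (𝓡 m) 𝓘(ℝ, F) b y)
    (v : EuclideanSpace ℝ (Fin m)) :
    dfun m (fun z ↦ a z - b z) y v = dfun m a y v - dfun m b y v :=
  congrArg (fun L : EuclideanSpace ℝ (Fin m) →L[ℝ] F ↦ L v) (mvfderiv_fun_sub ha hb)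

theorem dfun_const (c : F) (y : M) (v : EuclideanSpace ℝ (Fin m)) :
    dfun m (fun _ : M ↦ c) y v = 0 :=
  congrArg (fun L : EuclideanSpace ℝ (Fin m) →L[ℝ] F ↦ L v) (mvfderiv_const c)

variable [IsManifold (𝓡 m) ∞ M]

theorem contMDiffOn_dfun_apply {U : Set M} (hU : IsOpen U) {h : M → F}
    (hh : ContMDiffOn (𝓡 m) 𝓘(ℝ, F) ∞ h U) {X : M → EuclideanSpace ℝ (Fin m)}
    (hX : SmoothOn U X) :
    ContMDiffOn (𝓡 m) 𝓘(ℝ, F) ∞ (fun y ↦ dfun m h y (X y)) U :=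
  contMDiffOn_mvfderiv_apply hU hh hX

theorem dfun_bracket {U : Set M} (hU : IsOpen U) {h : M → F}
    (hh : ContMDiffOn (𝓡 m) 𝓘(ℝ, F) ∞ h U) {X Y : M → EuclideanSpace ℝ (Fin m)}
    (hX : SmoothOn U X) (hY : SmoothOn U Y) {x : M} (hx : x ∈ U) :
    dfun m h x (bracket m X Y x)
      = dfun m (fun y ↦ dfun m h y (Y y)) x (X x) - dfun m (fun y ↦ dfun m h y (X y)) x (Y x) :=
  mvfderiv_mlieBracket hU hh hX hY hx

end ManifoldCalculus

/-! ### Christoffel symbols of a metric on a vector space. -/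

section Christoffel

set_option maxSynthPendingDepth 3

variable {E : Type*} [NormedAddCommGroup E] [NormedSpace ℝ E]

/-- `ContinuousLinearMap.inverse` is zero on a non-invertible map, so `sharp` and `tangentPart` mean
what they should only once invertibility is known. -/
theorem isInvertible_of_nondegenerate [FiniteDimensional ℝ E] {B : E →L[ℝ] E →L[ℝ] ℝ}
    (hB : ∀ v, (∀ w, B v w = 0) → v = 0) : B.IsInvertible := by
  have hinj : Function.Injective (B : E →ₗ[ℝ] (E →L[ℝ] ℝ)) := by
    rw [injective_iff_map_eq_zero]
    intro v hv
    exact hB v fun w ↦ congrArg (fun L : E →L[ℝ] ℝ ↦ L w) hv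
  have hdim : Module.finrank ℝ E = Module.finrank ℝ (E →L[ℝ] ℝ) := by
    rw [← (LinearMap.toContinuousLinearMap : (E →ₗ[ℝ] ℝ) ≃ₗ[ℝ] (E →L[ℝ] ℝ)).finrank_eq]
    exact (Subspace.dual_finrank_eq (K := ℝ) (V := E)).symm
  refine ⟨(LinearEquiv.ofInjectiveOfFinrankEq (B : E →ₗ[ℝ] (E →L[ℝ] ℝ)) hinj
    hdim).toContinuousLinearEquiv, ?_⟩
  ext v w
  rfl

/-- The Koszul combination of the first derivatives of a metric. -/
noncomputable def koszul (T : E →L[ℝ] E →L[ℝ] E →L[ℝ] ℝ) : E →L[ℝ] E →L[ℝ] E →L[ℝ] ℝ :=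
  (1 / 2 : ℝ) • (T + T.flip
    - ((ContinuousLinearMap.flipₗᵢ ℝ E E ℝ).toContinuousLinearEquiv :
        (E →L[ℝ] E →L[ℝ] ℝ) →L[ℝ] (E →L[ℝ] E →L[ℝ] ℝ)) ∘L T.flip)

theorem koszul_apply (T : E →L[ℝ] E →L[ℝ] E →L[ℝ] ℝ) (v w u : E) :
    koszul T v w u = 1 / 2 * (T v w u + T w v u - T u v w) := by
  simp [koszul]

/-- The Christoffel symbols of the second kind of a field of bilinear forms. -/
noncomputable def christoffelOf (G : E → E →L[ℝ] E →L[ℝ] ℝ) (a : E) : E →L[ℝ] E →L[ℝ] E :=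
  (ContinuousLinearMap.compL ℝ E (E →L[ℝ] ℝ) E (G a).inverse) ∘L koszul (fderiv ℝ G a)

theorem christoffelOf_apply (G : E → E →L[ℝ] E →L[ℝ] ℝ) (a v w : E) :
    christoffelOf G a v w = (G a).inverse (koszul (fderiv ℝ G a) v w) := rfl

theorem contDiffAt_christoffelOf [CompleteSpace E] {G : E → E →L[ℝ] E →L[ℝ] ℝ} {a : E}
    (hG : ContDiffAt ℝ ∞ G a)
    (hi : (G a).IsInvertible) : ContDiffAt ℝ ∞ (christoffelOf G) a := by
  have h1 : ContDiffAt ℝ ∞ (fun b ↦ (G b).inverse) a := (hi.contDiffAt_map_inverse).comp a hG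
  have h2 : ContDiffAt ℝ ∞ (fderiv ℝ G) a := hG.fderiv_right (by simp)
  have h3 : ContDiffAt ℝ ∞ (fun b ↦ (fderiv ℝ G b).flip) a :=
    (ContinuousLinearMap.flipₗᵢ ℝ E E (E →L[ℝ] ℝ)).contDiff.contDiffAt.comp a h2
  have h4 : ContDiffAt ℝ ∞ (fun b ↦ koszul (fderiv ℝ G b)) a :=
    ((h2.add h3).sub (contDiffAt_const.clm_comp h3)).const_smul (1 / 2 : ℝ)
  exact ((ContinuousLinearMap.compL ℝ E (E →L[ℝ] ℝ) E).contDiff.contDiffAt.comp a h1).clm_comp h4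

section

variable {G : E → E →L[ℝ] E →L[ℝ] ℝ} {a : E}

theorem apply_christoffelOf (hi : (G a).IsInvertible) (v w u : E) :
    G a (christoffelOf G a v w) u = 1 / 2 *
      (fderiv ℝ G a v w u + fderiv ℝ G a w v u - fderiv ℝ G a u v w) := by
  rw [christoffelOf_apply, hi.self_apply_inverse, koszul_apply]

theorem fderiv_symm_of_symm (hd : DifferentiableAt ℝ G a)
    (hs : ∀ᶠ b in 𝓝 a, ∀ v w, G b v w = G b w v) (c v w : E) :
    fderiv ℝ G a c v w = fderiv ℝ G a c w v := by
  have h (v w : E) : HasFDerivAt (fun b ↦ G b v w) _ a :=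
    (hd.hasFDerivAt.clm_apply (hasFDerivAt_const v a)).clm_apply (hasFDerivAt_const w a)
  have e : (fun b ↦ G b v w) =ᶠ[𝓝 a] fun b ↦ G b w v := hs.mono fun b hb ↦ hb v w
  have := congrArg (fun L : E →L[ℝ] ℝ ↦ L c) (((h v w).congr_of_eventuallyEq e.symm).unique (h w v))
  simpa using this

theorem christoffelOf_symm (hd : DifferentiableAt ℝ G a)
    (hs : ∀ᶠ b in 𝓝 a, ∀ v w, G b v w = G b w v) (v w : E) :
    christoffelOf G a v w = christoffelOf G a w v := by
  rw [christoffelOf_apply, christoffelOf_apply]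
  congr 1
  ext u
  rw [koszul_apply, koszul_apply, fderiv_symm_of_symm hd hs u v w]
  ring

theorem christoffelOf_metric (hd : DifferentiableAt ℝ G a)
    (hs : ∀ᶠ b in 𝓝 a, ∀ v w, G b v w = G b w v) (hi : (G a).IsInvertible) (v z w : E) :
    fderiv ℝ G a v z w = G a (christoffelOf G a v z) w + G a z (christoffelOf G a v w) := by
  rw [hs.self_of_nhds z, apply_christoffelOf hi, apply_christoffelOf hi,
    fderiv_symm_of_symm hd hs v w z, fderiv_symm_of_symm hd hs w v z,
    fderiv_symm_of_symm hd hs z v w]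
  ring

/-- The transformation law of the Christoffel symbols under a change of coordinates. -/
theorem christoffelOf_change {G' : E → E →L[ℝ] E →L[ℝ] ℝ} {ψ : E → E} (hψ : ContDiffAt ℝ ∞ ψ a)
    (hG : DifferentiableAt ℝ G a) (hG' : DifferentiableAt ℝ G' (ψ a))
    (hGG' : ∀ᶠ b in 𝓝 a, ∀ v w, G b v w = G' (ψ b) (fderiv ℝ ψ b v) (fderiv ℝ ψ b w))
    (hi : (G a).IsInvertible) (hi' : (G' (ψ a)).IsInvertible)
    (hs' : ∀ v w, G' (ψ a) v w = G' (ψ a) w v)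
    (hsurj : Function.Surjective (fderiv ℝ ψ a)) (v w : E) :
    fderiv ℝ ψ a (christoffelOf G a v w) =
      christoffelOf G' (ψ a) (fderiv ℝ ψ a v) (fderiv ℝ ψ a w) + fderiv ℝ (fderiv ℝ ψ) a v w := by
  have hψ2 : DifferentiableAt ℝ (fderiv ℝ ψ) a :=
    (hψ.fderiv_right (m := 1) (by rw [one_add_one_eq_two]; exact ENat.LEInfty.out)).differentiableAt
      (by simp)
  have hψ1 : DifferentiableAt ℝ ψ a := hψ.differentiableAt (by simp)
  -- Derivative of the identity G = ψ^*G'. In the Koszul combination of three such formulas, the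
  -- Hessian terms cancel by symmetry except the pairing of ψ''(v, w) with dψ u.
  have key (c v w : E) : fderiv ℝ G a c v w =
      fderiv ℝ G' (ψ a) (fderiv ℝ ψ a c) (fderiv ℝ ψ a v) (fderiv ℝ ψ a w)
      + G' (ψ a) (fderiv ℝ (fderiv ℝ ψ) a c v) (fderiv ℝ ψ a w)
      + G' (ψ a) (fderiv ℝ ψ a v) (fderiv ℝ (fderiv ℝ ψ) a c w) := by
    have h1 : HasFDerivAt (fun b ↦ G b v w) _ a :=
      (hG.hasFDerivAt.clm_apply (hasFDerivAt_const v a)).clm_apply (hasFDerivAt_const w a)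
    have h2 (v : E) := hψ2.hasFDerivAt.clm_apply (hasFDerivAt_const v a)
    have h3 : HasFDerivAt (fun b ↦ G' (ψ b) (fderiv ℝ ψ b v) (fderiv ℝ ψ b w)) _ a :=
      ((hG'.hasFDerivAt.comp a hψ1.hasFDerivAt).clm_apply (h2 v)).clm_apply (h2 w)
    have e : (fun b ↦ G b v w) =ᶠ[𝓝 a] fun b ↦ G' (ψ b) (fderiv ℝ ψ b v) (fderiv ℝ ψ b w) :=
      hGG'.mono fun b hb ↦ hb v w
    have := congrArg (fun L : E →L[ℝ] ℝ ↦ L c) ((h1.congr_of_eventuallyEq e.symm).unique h3)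
    simp at this
    linarith
  have hsym : ∀ u v, fderiv ℝ (fderiv ℝ ψ) a u v = fderiv ℝ (fderiv ℝ ψ) a v u :=
    fun u v ↦ (hψ.isSymmSndFDerivAt (by simpa using ENat.LEInfty.out)) u v
  -- By nondegeneracy it suffices to pair both sides under G' with an arbitrary vector, which by
  -- surjectivity has the form dψ u.
  rw [← hi'.inverse_apply_self (fderiv ℝ ψ a (christoffelOf G a v w)),
    ← hi'.inverse_apply_self (christoffelOf G' (ψ a) (fderiv ℝ ψ a v) (fderiv ℝ ψ a w) + _)]
  congr 1
  ext u'
  obtain ⟨u, rfl⟩ := hsurj u'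
  rw [← hGG'.self_of_nhds, apply_christoffelOf hi, map_add, add_apply, apply_christoffelOf hi',
    key, key, key, hsym w v, hsym u v, hsym u w,
    hs' (fderiv ℝ ψ a w)]
  ring

end

end Christoffel

/-! ### Tangent vectors and the Lorentzian metric read in a chart. -/

section Charts

set_option maxSynthPendingDepth 3

variable {V : Type*} [TopologicalSpace V] [ChartedSpace E4 V] [IsManifold (𝓡 4) ∞ V]

/-- The components in the preferred chart at `p` of a vector tangent at `q`. -/
noncomputable def toChart (p q : V) : E4 →L[ℝ] E4 :=
  have := IsManifold.of_le (I := 𝓡 4) (M := V) (m := 1) (n := ∞) (by simp)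
  tangentCoordChange (𝓡 4) q p q

theorem trivializationAt_snd (p q : V) (v : TangentSpace (𝓡 4) q) :
    (trivializationAt E4 (TangentSpace (𝓡 4)) p ⟨q, v⟩).2 = toChart p q v := rfl

theorem toChart_self (p : V) (v : E4) : toChart p p v = v :=
  have := IsManifold.of_le (I := 𝓡 4) (M := V) (m := 1) (n := ∞) (by simp)
  tangentCoordChange_self (mem_extChartAt_source p)

theorem toChart_bijective {p q : V} (h : q ∈ (extChartAt (𝓡 4) p).source) :
    Function.Bijective (toChart p q) := by
  have := IsManifold.of_le (I := 𝓡 4) (M := V) (m := 1) (n := ∞) (by simp)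
  have hq := mem_extChartAt_source (I := 𝓡 4) q
  refine Function.bijective_iff_has_inverse.2 ⟨tangentCoordChange (𝓡 4) p q q, fun v ↦ ?_, fun v ↦ ?_⟩
  · exact (tangentCoordChange_comp ⟨⟨hq, h⟩, hq⟩).trans (tangentCoordChange_self hq)
  · exact (tangentCoordChange_comp ⟨⟨h, hq⟩, h⟩).trans (tangentCoordChange_self h)

theorem mfderiv_extChartAt_eq_toChart {p q : V} (h : q ∈ (extChartAt (𝓡 4) p).source)
    (v : TangentSpace (𝓡 4) q) : mvfderiv (𝓡 4) (extChartAt (𝓡 4) p) q v = toChart p q v := by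
  have := IsManifold.of_le (I := 𝓡 4) (M := V) (m := 1) (n := ∞) (by simp)
  rw [extChartAt_source] at h
  rw [← trivializationAt_snd]
  have h1 := TangentBundle.continuousLinearMapAt_trivializationAt (I := 𝓡 4) h
  have h2 := congrArg (fun L : E4 →L[ℝ] E4 ↦ L v) h1
  refine Eq.trans h2.symm ?_
  exact (trivializationAt E4 (TangentSpace (𝓡 4)) p).continuousLinearMapAt_apply_of_mem ℝ h v

/-- The transition map between the preferred charts at `q` and at `p`. -/
noncomputable def transition (q p : V) : E4 → E4 := extChartAt (𝓡 4) p ∘ (extChartAt (𝓡 4) q).symm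

theorem toChart_eq_fderiv_transition {p q r : V} (hp : r ∈ (extChartAt (𝓡 4) p).source)
    (hq : r ∈ (extChartAt (𝓡 4) q).source) (v : E4) :
    toChart p r v = fderiv ℝ (transition q p) (extChartAt (𝓡 4) q r) (toChart q r v) := by
  have := IsManifold.of_le (I := 𝓡 4) (M := V) (m := 1) (n := ∞) (by simp)
  have h1 := tangentCoordChange_comp (I := 𝓡 4) (w := r) (x := q) (y := p) (z := r) (v := v)
    ⟨⟨mem_extChartAt_source r, hq⟩, hp⟩
  rw [tangentCoordChange_def (x := q) (y := p), ModelWithCorners.Boundaryless.range_eq_univ,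
    fderivWithin_univ] at h1
  exact h1.symm

theorem contDiffAt_transition {p q r : V} (hp : r ∈ (extChartAt (𝓡 4) p).source)
    (hq : r ∈ (extChartAt (𝓡 4) q).source) :
    ContDiffAt ℝ ∞ (transition q p) (extChartAt (𝓡 4) q r) := by
  have h := contDiffWithinAt_ext_coord_change (I := 𝓡 4) (n := ∞) p q (y := extChartAt (𝓡 4) q r) (by
    rw [PartialEquiv.trans_source'', PartialEquiv.symm_symm, PartialEquiv.symm_target]
    exact Set.mem_image_of_mem _ ⟨hq, hp⟩)
  rwa [ModelWithCorners.Boundaryless.range_eq_univ, contDiffWithinAt_univ] at h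

variable (g : LorentzMetric V)

theorem LorentzMetric.coords_apply {p q : V} (h : q ∈ (extChartAt (𝓡 4) p).source) (v w : E4) :
    g.coords p q (toChart p q v) (toChart p q w) = g.val q v w := by
  rw [extChartAt_source] at h
  have h1 := inCoordinates_apply_eq₂ (𝕜 := ℝ) (F₁ := E4) (E₁ := fun r : V ↦ TangentSpace (𝓡 4) r)
    (F₂ := E4) (E₂ := fun r : V ↦ TangentSpace (𝓡 4) r) (F₃ := ℝ) (E₃ := fun _ : V ↦ ℝ)
    (x₀ := p) (x := q) (ϕ := g.val q) (v := toChart p q v) (w := toChart p q w) h h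
    (by simp)
  have h2 (v : E4) : (trivializationAt E4 (TangentSpace (𝓡 4)) p).symm q (toChart p q v) = v :=
    Bundle.Trivialization.symm_apply_apply_mk (trivializationAt E4 (TangentSpace (𝓡 4)) p) h v
  rw [h2, h2] at h1
  refine Eq.trans h1 ?_
  simp

theorem LorentzMetric.contMDiffOn_coords (p : V) :
    ContMDiffOn (𝓡 4) 𝓘(ℝ, E4 →L[ℝ] E4 →L[ℝ] ℝ) ∞ (g.coords p) (extChartAt (𝓡 4) p).source := by
  have h := g.contMDiff
  rw [extChartAt_source]
  intro q hq
  have h1 := (Bundle.Trivialization.contMDiffAt_iff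
    (e := trivializationAt (E4 →L[ℝ] E4 →L[ℝ] ℝ)
    (fun r : V ↦ TangentSpace (𝓡 4) r →L[ℝ] TangentSpace (𝓡 4) r →L[ℝ] ℝ) p)
    (IB := 𝓡 4) (n := ∞)
    (f := fun p ↦ Bundle.TotalSpace.mk' (E4 →L[ℝ] E4 →L[ℝ] ℝ)
      (E := fun p : V ↦ TangentSpace (𝓡 4) p →L[ℝ] TangentSpace (𝓡 4) p →L[ℝ] ℝ) p (g.val p))
    (x₀ := q) (by simpa using hq)).1 (g.contMDiff q)
  exact h1.2.contMDiffWithinAt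

/-- A vector of the radical is orthogonal to the timelike `t`, so it would have positive square if
nonzero. -/
theorem LorentzMetric.nondegenerate (p : V) (v : E4) (h : ∀ w : E4, g.val p v w = 0) : v = 0 := by
  obtain ⟨t, -, ht⟩ := g.signature p
  by_contra hv
  have := ht v ((g.symm p t v).trans (h t)) hv
  exact this.ne' (h v)

/-- The metric in the preferred chart at `p`. -/
noncomputable def LorentzMetric.inChart (p : V) (a : E4) : E4 →L[ℝ] E4 →L[ℝ] ℝ :=
  g.coords p ((extChartAt (𝓡 4) p).symm a)

variable {g}

theorem LorentzMetric.inChart_extChartAt {p q : V} (h : q ∈ (extChartAt (𝓡 4) p).source) :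
    g.inChart p (extChartAt (𝓡 4) p q) = g.coords p q := by
  rw [LorentzMetric.inChart, (extChartAt (𝓡 4) p).left_inv h]

theorem LorentzMetric.inChart_apply {p q : V} (h : q ∈ (extChartAt (𝓡 4) p).source) (v w : E4) :
    g.inChart p (extChartAt (𝓡 4) p q) (toChart p q v) (toChart p q w) = g.val q v w := by
  rw [LorentzMetric.inChart_extChartAt h, g.coords_apply h]

theorem LorentzMetric.contDiffAt_inChart {p q : V} (h : q ∈ (extChartAt (𝓡 4) p).source) :
    ContDiffAt ℝ ∞ (g.inChart p) (extChartAt (𝓡 4) p q) := by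
  rw [← contMDiffAt_iff_contDiffAt]
  have h2 := (contMDiffOn_extChartAt_symm (I := 𝓡 4) (n := ∞) p).contMDiffAt
    (extChartAt_target_mem_nhds' (I := 𝓡 4) ((extChartAt (𝓡 4) p).map_source h))
  refine ContMDiffAt.comp _ ?_ h2
  rw [(extChartAt (𝓡 4) p).left_inv h]
  exact (g.contMDiffOn_coords p).contMDiffAt (extChartAt_source_mem_nhds' h)

theorem LorentzMetric.inChart_symm {p q : V} (h : q ∈ (extChartAt (𝓡 4) p).source) (v w : E4) :
    g.inChart p (extChartAt (𝓡 4) p q) v w = g.inChart p (extChartAt (𝓡 4) p q) w v := by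
  obtain ⟨v, rfl⟩ := (toChart_bijective h).2 v
  obtain ⟨w, rfl⟩ := (toChart_bijective h).2 w
  rw [LorentzMetric.inChart_apply h, LorentzMetric.inChart_apply h]
  exact g.symm q v w

theorem LorentzMetric.eventually_inChart_symm {p q : V} (h : q ∈ (extChartAt (𝓡 4) p).source) :
    ∀ᶠ b in 𝓝 (extChartAt (𝓡 4) p q), ∀ v w, g.inChart p b v w = g.inChart p b w v := by
  filter_upwards [extChartAt_target_mem_nhds' (I := 𝓡 4) ((extChartAt (𝓡 4) p).map_source h)]
    with b hb v w
  have := LorentzMetric.inChart_symm (g := g) ((extChartAt (𝓡 4) p).map_target hb) v w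
  rwa [(extChartAt (𝓡 4) p).right_inv hb] at this

theorem LorentzMetric.isInvertible_inChart {p q : V} (h : q ∈ (extChartAt (𝓡 4) p).source) :
    (g.inChart p (extChartAt (𝓡 4) p q)).IsInvertible := by
  refine isInvertible_of_nondegenerate fun v hv ↦ ?_
  obtain ⟨v, rfl⟩ := (toChart_bijective h).2 v
  rw [g.nondegenerate q v fun w ↦ ?_, map_zero]
  rw [← LorentzMetric.inChart_apply h, hv]

theorem LorentzMetric.inChart_change {p q : V} (h : q ∈ (extChartAt (𝓡 4) p).source) :
    ∀ᶠ b in 𝓝 (extChartAt (𝓡 4) q q), ∀ v w, g.inChart q b v w =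
      g.inChart p (transition q p b) (fderiv ℝ (transition q p) b v)
        (fderiv ℝ (transition q p) b w) := by
  have h1 : ∀ᶠ b in 𝓝 (extChartAt (𝓡 4) q q),
      (extChartAt (𝓡 4) q).symm b ∈ (extChartAt (𝓡 4) p).source :=
    (continuousAt_extChartAt_symm q).eventually (by
      rw [extChartAt_to_inv]
      exact extChartAt_source_mem_nhds' h)
  filter_upwards [h1, extChartAt_target_mem_nhds (I := 𝓡 4) q] with b hb hbt v w
  obtain ⟨r, hr, rfl⟩ : ∃ r ∈ (extChartAt (𝓡 4) q).source, extChartAt (𝓡 4) q r = b :=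
    ⟨_, (extChartAt (𝓡 4) q).map_target hbt, (extChartAt (𝓡 4) q).right_inv hbt⟩
  rw [(extChartAt (𝓡 4) q).left_inv hr] at hb
  obtain ⟨v, rfl⟩ := (toChart_bijective hr).2 v
  obtain ⟨w, rfl⟩ := (toChart_bijective hr).2 w
  rw [← toChart_eq_fderiv_transition hb hr, ← toChart_eq_fderiv_transition hb hr, transition,
    Function.comp_apply, (extChartAt (𝓡 4) q).left_inv hr, LorentzMetric.inChart_apply hr,
    LorentzMetric.inChart_apply hb]

theorem LorentzMetric.inChart_self (p : V) : g.inChart p (extChartAt (𝓡 4) p p) = g.val p := by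
  ext v w
  have := LorentzMetric.inChart_apply (g := g) (mem_extChartAt_source p) v w
  rwa [toChart_self, toChart_self] at this

/-- At `p` itself the manifold derivative is by definition taken in the preferred chart at `p`, so
no change of coordinates enters. -/
theorem LorentzMetric.dcoords_eq (p : V) :
    g.dcoords p = fderiv ℝ (g.inChart p) (extChartAt (𝓡 4) p p) := by
  have h1 : MDifferentiableAt (𝓡 4) 𝓘(ℝ, E4 →L[ℝ] E4 →L[ℝ] ℝ) (g.coords p) p :=
    ((g.contMDiffOn_coords p).contMDiffAt (extChartAt_source_mem_nhds p)).mdifferentiableAt (by simp)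
  have h2 := h1.mvfderiv
  rw [ModelWithCorners.Boundaryless.range_eq_univ, fderivWithin_univ] at h2
  exact h2

theorem LorentzMetric.christoffel_eq (p : V) (v w : E4) :
    g.christoffel p v w = christoffelOf (g.inChart p) (extChartAt (𝓡 4) p p) v w := by
  rw [christoffelOf_apply, LorentzMetric.inChart_self]
  change (g.val p).inverse _ = (g.val p).inverse _
  congr 1
  ext u
  rw [koszul_apply, ← LorentzMetric.dcoords_eq]
  simp

end Charts

/-! ### The connection along a map: independence of the chart, and smoothness. -/

section AlongMap

set_option maxSynthPendingDepth 3

variable {V : Type*} [TopologicalSpace V] [ChartedSpace E4 V] [IsManifold (𝓡 4) ∞ V]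
variable {m : ℕ} {M : Type*} [TopologicalSpace M] [ChartedSpace (EuclideanSpace ℝ (Fin m)) M]

/-- The differential of `f`, in the preferred charts. -/
noncomputable def dmap (f : M → V) (y : M) : EuclideanSpace ℝ (Fin m) →L[ℝ] E4 :=
  mfderiv (𝓡 m) (𝓡 4) f y

/-- The components in the chart at `p` of a vector field along `f`. -/
noncomputable def chartSec {M : Type*} (p : V) (f : M → V) (Z : M → E4) (y : M) : E4 :=
  toChart p (f y) (Z y)

theorem chartSec_self {M : Type*} {f : M → V} {Z : M → E4} (y : M) :
    chartSec (f y) f Z y = Z y := toChart_self _ _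

/-- A map, read in the chart at `p`. -/
noncomputable def chartMap {M : Type*} (p : V) (f : M → V) (y : M) : E4 := extChartAt (𝓡 4) p (f y)

/-- Smooth vector fields along `f` on a subset. -/
def SmoothAlong (m : ℕ) [ChartedSpace (EuclideanSpace ℝ (Fin m)) M] (f : M → V) (U : Set M)
    (Z : M → E4) : Prop :=
  ContMDiffOn (𝓡 m) (𝓡 4).tangent ∞ (fun y ↦ (⟨f y, Z y⟩ : TangentBundle (𝓡 4) V)) U

/-- The Levi-Civita connection on vector fields along `f`. -/
noncomputable def covAlong (g : LorentzMetric V) (f : M → V) (Z : M → E4) (y : M)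
    (v : EuclideanSpace ℝ (Fin m)) : E4 :=
  dfun m (chartSec (f y) f Z) y v
    + christoffelOf (g.inChart (f y)) (chartMap (f y) f y) (dmap f y v) (Z y)

variable {g : LorentzMetric V} {f : M → V} {U : Set M} {Z W : M → E4}

theorem SmoothAlong.base (h : SmoothAlong m f U Z) : ContMDiffOn (𝓡 m) (𝓡 4) ∞ f U :=
  (Bundle.contMDiff_proj (TangentSpace (𝓡 4))).comp_contMDiffOn h

theorem SmoothAlong.contMDiffAt_chartSec (h : SmoothAlong m f U Z) (hU : IsOpen U) {p : V} {y : M}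
    (hy : y ∈ U) (hp : f y ∈ (extChartAt (𝓡 4) p).source) :
    ContMDiffAt (𝓡 m) 𝓘(ℝ, E4) ∞ (chartSec p f Z) y := by
  rw [extChartAt_source] at hp
  have h1 := (Bundle.Trivialization.contMDiffAt_iff
    (e := trivializationAt E4 (TangentSpace (𝓡 4)) p) (IB := 𝓡 4) (IM := 𝓡 m) (n := ∞)
    (f := fun y ↦ (⟨f y, Z y⟩ : TangentBundle (𝓡 4) V))
    (x₀ := y) (by simpa using hp)).1 (h.contMDiffAt (hU.mem_nhds hy))
  exact h1.2

theorem smoothAlong_of_chartSec (hU : IsOpen U) (hf : ContMDiffOn (𝓡 m) (𝓡 4) ∞ f U)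
    (h : ∀ y ∈ U, ContMDiffAt (𝓡 m) 𝓘(ℝ, E4) ∞ (chartSec (f y) f Z) y) : SmoothAlong m f U Z :=
  fun y hy ↦ ((Bundle.contMDiffAt_totalSpace
    (f := fun y ↦ (⟨f y, Z y⟩ : TangentBundle (𝓡 4) V)) (x₀ := y)).2
      ⟨hf.contMDiffAt (hU.mem_nhds hy), h y hy⟩).contMDiffWithinAt

theorem contMDiffAt_chartMap {p : V} {y : M} (hf : ContMDiffAt (𝓡 m) (𝓡 4) ∞ f y)
    (hp : f y ∈ (extChartAt (𝓡 4) p).source) :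
    ContMDiffAt (𝓡 m) 𝓘(ℝ, E4) ∞ (chartMap p f) y :=
  (contMDiffAt_extChartAt' (by simpa using hp)).comp y hf

theorem dfun_chartMap {p : V} {y : M} (hf : MDifferentiableAt (𝓡 m) (𝓡 4) f y)
    (hp : f y ∈ (extChartAt (𝓡 4) p).source) (v : EuclideanSpace ℝ (Fin m)) :
    dfun m (chartMap p f) y v = toChart p (f y) (dmap f y v) := by
  have := IsManifold.of_le (I := 𝓡 4) (M := V) (m := 1) (n := ∞) (by simp)
  have hp' := hp
  rw [extChartAt_source] at hp'
  have h1 := mfderiv_comp_apply (I := 𝓡 m) (I' := 𝓡 4) (I'' := 𝓘(ℝ, E4)) y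
    (mdifferentiableAt_extChartAt (I := 𝓡 4) hp') hf v
  exact h1.trans (mfderiv_extChartAt_eq_toChart hp _)

theorem dfun_chartMap_self {y : M} (hf : MDifferentiableAt (𝓡 m) (𝓡 4) f y)
    (v : EuclideanSpace ℝ (Fin m)) :
    dfun m (chartMap (f y) f) y v = dmap f y v :=
  (dfun_chartMap hf (mem_extChartAt_source _) v).trans (toChart_self _ _)

/-- The connection along `f` may be computed in any chart. -/
theorem toChart_covAlong (h : SmoothAlong m f U Z) (hU : IsOpen U) {p : V} {y : M} (hy : y ∈ U)
    (hp : f y ∈ (extChartAt (𝓡 4) p).source) (v : EuclideanSpace ℝ (Fin m)) :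
    toChart p (f y) (covAlong g f Z y v) = dfun m (chartSec p f Z) y v
      + christoffelOf (g.inChart p) (chartMap p f y) (dfun m (chartMap p f) y v)
        (chartSec p f Z y) := by
  have hq := mem_extChartAt_source (I := 𝓡 4) (f y)
  have hfa := h.base.contMDiffAt (hU.mem_nhds hy)
  have hf : MDifferentiableAt (𝓡 m) (𝓡 4) f y := mdifferentiableAt_of_contMDiffOn hU h.base hy
  set ψ := transition (f y) p with hψdef
  have hψ : ContDiffAt ℝ ∞ ψ (chartMap (f y) f y) := contDiffAt_transition hp hq
  have hψ2 : DifferentiableAt ℝ (fderiv ℝ ψ) (chartMap (f y) f y) :=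
    (hψ.fderiv_right (m := 1) (by rw [one_add_one_eq_two]; exact ENat.LEInfty.out)).differentiableAt
      (by simp)
  have hcm : MDifferentiableAt (𝓡 m) 𝓘(ℝ, E4) (chartMap (f y) f) y :=
    (contMDiffAt_chartMap hfa hq).mdifferentiableAt (by simp)
  have hcs : MDifferentiableAt (𝓡 m) 𝓘(ℝ, E4) (chartSec (f y) f Z) y :=
    (h.contMDiffAt_chartSec hU hy hq).mdifferentiableAt (by simp)
  -- Near `y` the components at `p` are dψ applied to those at `f y`. Differentiating produces the
  -- Hessian of ψ, exactly the inhomogeneous term of `christoffelOf_change`.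
  have h1 : chartSec p f Z =ᶠ[𝓝 y]
      fun z ↦ fderiv ℝ ψ (chartMap (f y) f z)
        (chartSec (f y) f Z z) := by
    filter_upwards [hf.continuousAt.eventually (extChartAt_source_mem_nhds' hp),
      hf.continuousAt.eventually (extChartAt_source_mem_nhds' hq)] with z hz hz'
    exact toChart_eq_fderiv_transition hz hz' _
  have hd : MDifferentiableAt (𝓡 m) 𝓘(ℝ, E4 →L[ℝ] E4) (fun z ↦ fderiv ℝ ψ (chartMap (f y) f z)) y :=
    hψ2.mdifferentiableAt.comp y hcm
  rw [dfun_congr h1, dfun_clm_apply hd hcs, dfun_comp hψ2 hcm,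
    dfun_chartMap_self hf, dfun_chartMap hf hp, chartSec_self, covAlong, map_add]
  have hT (w : E4) : toChart p (f y) w = fderiv ℝ ψ (chartMap (f y) f y) w :=
    (toChart_eq_fderiv_transition hp hq w).trans (by rw [toChart_self]; rfl)
  have hψa : ψ (chartMap (f y) f y) = chartMap p f y := by
    simp only [hψdef, transition, chartMap, Function.comp_apply, extChartAt_to_inv]
  have hch := christoffelOf_change (G := g.inChart (f y)) (G' := g.inChart p) hψ
    ((LorentzMetric.contDiffAt_inChart hq).differentiableAt (by simp))
    (by rw [hψa]; exact (LorentzMetric.contDiffAt_inChart hp).differentiableAt (by simp))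
    (LorentzMetric.inChart_change hp) (LorentzMetric.isInvertible_inChart hq)
    (by rw [hψa]; exact LorentzMetric.isInvertible_inChart hp)
    (by rw [hψa]; exact LorentzMetric.inChart_symm hp)
    (fun w ↦ by
      obtain ⟨w, rfl⟩ := (toChart_bijective hp).2 w
      exact ⟨w, (hT w).symm⟩) (dmap f y v) (Z y)
  rw [hψa] at hch
  simp only [chartSec, hT] at hch ⊢
  rw [hch]
  abel

theorem contMDiffAt_christoffelOf_chartMap {x : M}
    (hc : ContMDiffAt (𝓡 m) 𝓘(ℝ, E4) ∞ (chartMap (f x) f) x) :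
    ContMDiffAt (𝓡 m) 𝓘(ℝ, E4 →L[ℝ] E4 →L[ℝ] E4) ∞
      (fun y ↦ christoffelOf (g.inChart (f x)) (chartMap (f x) f y)) x := by
  have hq := mem_extChartAt_source (I := 𝓡 4) (f x)
  have h : ContDiffAt ℝ ∞ (christoffelOf (g.inChart (f x))) (chartMap (f x) f x) :=
    contDiffAt_christoffelOf (LorentzMetric.contDiffAt_inChart hq)
      (LorentzMetric.isInvertible_inChart hq)
  exact h.comp_contMDiffAt hc

/-- In the definition of `covAlong` the chart moves with `y`, which hides smoothness;
`toChart_covAlong` rewrites everything near `x` in the one chart at `f x`. -/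
theorem SmoothAlong.cov [IsManifold (𝓡 m) ∞ M] (h : SmoothAlong m f U Z) (hU : IsOpen U)
    {X : M → EuclideanSpace ℝ (Fin m)} (hX : SmoothOn U X) :
    SmoothAlong m f U (fun y ↦ covAlong g f Z y (X y)) := by
  refine smoothAlong_of_chartSec hU h.base fun x hx ↦ ?_
  have hW : IsOpen (U ∩ f ⁻¹' (extChartAt (𝓡 4) (f x)).source) :=
    h.base.continuousOn.isOpen_inter_preimage hU (isOpen_extChartAt_source _)
  set O := U ∩ f ⁻¹' (extChartAt (𝓡 4) (f x)).source
  have hxO : x ∈ O := ⟨hx, mem_extChartAt_source _⟩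
  have h1 : ContMDiffOn (𝓡 m) 𝓘(ℝ, E4) ∞ (chartSec (f x) f Z) O := fun y hy ↦
    (h.contMDiffAt_chartSec hU hy.1 hy.2).contMDiffWithinAt
  have h2 : ContMDiffOn (𝓡 m) 𝓘(ℝ, E4) ∞ (chartMap (f x) f) O := fun y hy ↦
    (contMDiffAt_chartMap (h.base.contMDiffAt (hU.mem_nhds hy.1)) hy.2).contMDiffWithinAt
  have hXO : SmoothOn O X := hX.mono Set.inter_subset_left
  have h3 := (contMDiffOn_dfun_apply hW h1 hXO).contMDiffAt (hW.mem_nhds hxO)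
  have h4 := (contMDiffOn_dfun_apply hW h2 hXO).contMDiffAt (hW.mem_nhds hxO)
  have hc : ContMDiffAt (𝓡 m) 𝓘(ℝ, E4) ∞ (chartMap (f x) f) x := h2.contMDiffAt (hW.mem_nhds hxO)
  have h5 : ContMDiffAt (𝓡 m) 𝓘(ℝ, E4 →L[ℝ] E4 →L[ℝ] E4) ∞
      (fun y ↦ christoffelOf (g.inChart (f x)) (chartMap (f x) f y)) x :=
    contMDiffAt_christoffelOf_chartMap hc
  have h6 := h3.add ((h5.clm_apply h4).clm_apply (h1.contMDiffAt (hW.mem_nhds hxO)))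
  refine h6.congr_of_eventuallyEq ?_
  filter_upwards [hW.mem_nhds hxO] with y hy
  exact toChart_covAlong h hU hy.1 hy.2 _

end AlongMap

/-! ### Metricity, vanishing torsion and curvature of the connection along a map. -/

section AlongMapIdentities

set_option maxSynthPendingDepth 3

variable {V : Type*} [TopologicalSpace V] [ChartedSpace E4 V] [IsManifold (𝓡 4) ∞ V]
variable {m : ℕ} {M : Type*} [TopologicalSpace M] [ChartedSpace (EuclideanSpace ℝ (Fin m)) M]
variable {g : LorentzMetric V} {f : M → V} {U : Set M} {Z W : M → E4}

theorem SmoothAlong.add (hZ : SmoothAlong m f U Z) (hW : SmoothAlong m f U W) (hU : IsOpen U) :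
    SmoothAlong m f U (fun y ↦ Z y + W y) := by
  refine smoothAlong_of_chartSec hU hZ.base fun x hx ↦ ?_
  have hp := mem_extChartAt_source (I := 𝓡 4) (f x)
  refine ((hZ.contMDiffAt_chartSec hU hx hp).add (hW.contMDiffAt_chartSec
    hU hx hp)).congr_of_eventuallyEq
    (.of_forall fun y ↦ ?_)
  simp [chartSec]

theorem SmoothAlong.sub (hZ : SmoothAlong m f U Z) (hW : SmoothAlong m f U W) (hU : IsOpen U) :
    SmoothAlong m f U (fun y ↦ Z y - W y) := by
  refine smoothAlong_of_chartSec hU hZ.base fun x hx ↦ ?_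
  have hp := mem_extChartAt_source (I := 𝓡 4) (f x)
  refine ((hZ.contMDiffAt_chartSec hU hx hp).sub (hW.contMDiffAt_chartSec
    hU hx hp)).congr_of_eventuallyEq
    (.of_forall fun y ↦ ?_)
  simp [chartSec]

theorem SmoothAlong.smul {a : M → ℝ} (ha : ContMDiffOn (𝓡 m) 𝓘(ℝ, ℝ) ∞ a U)
    (hZ : SmoothAlong m f U Z) (hU : IsOpen U) : SmoothAlong m f U (fun y ↦ a y • Z y) := by
  refine smoothAlong_of_chartSec hU hZ.base fun x hx ↦ ?_
  have hp := mem_extChartAt_source (I := 𝓡 4) (f x)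
  refine ((ha.contMDiffAt (hU.mem_nhds hx)).smul
    (hZ.contMDiffAt_chartSec hU hx hp)).congr_of_eventuallyEq (.of_forall fun y ↦ ?_)
  simp [chartSec]

theorem covAlong_sub (hZ : SmoothAlong m f U Z) (hW : SmoothAlong m f U W) (hU : IsOpen U) {x : M}
    (hx : x ∈ U) (v : EuclideanSpace ℝ (Fin m)) :
    covAlong g f (fun y ↦ Z y - W y) x v = covAlong g f Z x v - covAlong g f W x v := by
  have hp := mem_extChartAt_source (I := 𝓡 4) (f x)
  have h1 : chartSec (f x) f (fun y ↦ Z y - W y)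
      = fun y ↦ chartSec (f x) f Z y - chartSec (f x) f W y := by
    ext1 y
    simp [chartSec]
  rw [covAlong, covAlong, covAlong, h1,
    dfun_sub ((hZ.contMDiffAt_chartSec hU hx hp).mdifferentiableAt (by simp))
      ((hW.contMDiffAt_chartSec hU hx hp).mdifferentiableAt (by simp)), map_sub]
  abel

/-- The metric, as a bilinear form on the components in the preferred chart. -/
noncomputable def LorentzMetric.form (g : LorentzMetric V) (p : V) : E4 →L[ℝ] E4 →L[ℝ] ℝ := g.val p

theorem LorentzMetric.form_symm (g : LorentzMetric V) (p : V) (v w : E4) :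
    g.form p v w = g.form p w v := g.symm p v w

theorem LorentzMetric.inChart_chartSec {M : Type*} {f : M → V} {Z W : M → E4} {p : V} {y : M}
    (hp : f y ∈ (extChartAt (𝓡 4) p).source) :
    g.form (f y) (Z y) (W y) = g.inChart p (chartMap p f y) (chartSec p f Z y) (chartSec p f W y) :=
  (LorentzMetric.inChart_apply hp _ _).symm

omit [IsManifold (𝓡 4) ∞ V] in
theorem eventually_mem_chart {x : M} (hf : ContinuousAt f x) :
    ∀ᶠ y in 𝓝 x, f y ∈ (extChartAt (𝓡 4) (f x)).source :=
  hf.eventually (extChartAt_source_mem_nhds (f x))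

theorem contMDiffAt_inChart_chartMap {x : M}
    (hc : ContMDiffAt (𝓡 m) 𝓘(ℝ, E4) ∞ (chartMap (f x) f) x) :
    ContMDiffAt (𝓡 m) 𝓘(ℝ, E4 →L[ℝ] E4 →L[ℝ] ℝ) ∞
      (fun y ↦ g.inChart (f x) (chartMap (f x) f y)) x := by
  have h : ContDiffAt ℝ ∞ (g.inChart (f x)) (chartMap (f x) f x) :=
    LorentzMetric.contDiffAt_inChart (mem_extChartAt_source (I := 𝓡 4) (f x))
  exact h.comp_contMDiffAt hc

theorem SmoothAlong.form (hZ : SmoothAlong m f U Z) (hW : SmoothAlong m f U W) (hU : IsOpen U) :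
    ContMDiffOn (𝓡 m) 𝓘(ℝ, ℝ) ∞ (fun y ↦ g.form (f y) (Z y) (W y)) U := by
  intro x hx
  have hp := mem_extChartAt_source (I := 𝓡 4) (f x)
  have hf := hZ.base.contMDiffAt (hU.mem_nhds hx)
  have h1 := ((contMDiffAt_inChart_chartMap (g := g) (contMDiffAt_chartMap hf hp)).clm_apply
    (hZ.contMDiffAt_chartSec hU hx hp)).clm_apply (hW.contMDiffAt_chartSec hU hx hp)
  refine (h1.congr_of_eventuallyEq ?_).contMDiffWithinAt
  filter_upwards [eventually_mem_chart hf.continuousAt] with y hy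
  exact LorentzMetric.inChart_chartSec hy

/-- The connection is metric. -/
theorem dfun_form (hZ : SmoothAlong m f U Z) (hW : SmoothAlong m f U W) (hU : IsOpen U) {x : M}
    (hx : x ∈ U) (v : EuclideanSpace ℝ (Fin m)) :
    dfun m (fun y ↦ g.form (f y) (Z y) (W y)) x v
      = g.form (f x) (covAlong g f Z x v) (W x) + g.form (f x) (Z x) (covAlong g f W x v) := by
  have hp := mem_extChartAt_source (I := 𝓡 4) (f x)
  have hf := hZ.base.contMDiffAt (hU.mem_nhds hx)
  have hc := contMDiffAt_chartMap hf hp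
  have hG : DifferentiableAt ℝ (g.inChart (f x)) (chartMap (f x) f x) :=
    (LorentzMetric.contDiffAt_inChart hp).differentiableAt (by simp)
  have h1 : (fun y ↦ g.form (f y) (Z y) (W y)) =ᶠ[𝓝 x] fun y ↦
      g.inChart (f x) (chartMap (f x) f y) (chartSec (f x) f Z y) (chartSec (f x) f W y) := by
    filter_upwards [eventually_mem_chart hf.continuousAt] with y hy
    exact LorentzMetric.inChart_chartSec hy
  have hA := contMDiffAt_inChart_chartMap (g := g) hc
  have hZ' := hZ.contMDiffAt_chartSec hU hx hp
  have hW' := hW.contMDiffAt_chartSec hU hx hp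
  have hAZ := hA.clm_apply hZ'
  rw [dfun_congr h1, dfun_clm_apply (hAZ.mdifferentiableAt (by simp)) (hW'.mdifferentiableAt (by simp)),
    dfun_clm_apply (hA.mdifferentiableAt (by simp)) (hZ'.mdifferentiableAt (by simp)),
    dfun_comp hG (hc.mdifferentiableAt (by simp)), dfun_chartMap_self (hf.mdifferentiableAt (by simp))]
  have hs : g.inChart (f x) (chartMap (f x) f x) = g.form (f x) := LorentzMetric.inChart_self _
  have hm := christoffelOf_metric hG (LorentzMetric.eventually_inChart_symm hp)
    (LorentzMetric.isInvertible_inChart hp) (dmap f x v) (Z x) (W x)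
  change fderiv ℝ (g.inChart (f x)) (chartMap (f x) f x) (dmap f x v) (Z x) (W x) =
    g.inChart (f x) (chartMap (f x) f x)
      (christoffelOf (g.inChart (f x)) (chartMap (f x) f x) (dmap f x v) (Z x)) (W x)
    + g.inChart (f x) (chartMap (f x) f x) (Z x)
      (christoffelOf (g.inChart (f x)) (chartMap (f x) f x) (dmap f x v) (W x)) at hm
  rw [hs] at hm
  simp only [chartSec_self, hs, covAlong, map_add, add_apply, hm]
  ring

variable [IsManifold (𝓡 m) ∞ M]

theorem smoothAlong_dmap (hf : ContMDiffOn (𝓡 m) (𝓡 4) ∞ f U) (hU : IsOpen U)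
    {X : M → EuclideanSpace ℝ (Fin m)} (hX : SmoothOn U X) :
    SmoothAlong m f U (fun y ↦ dmap f y (X y)) :=
  hf.tangentMap_apply hU hX

/-- The connection is torsion-free. -/
theorem covAlong_dmap (hf : ContMDiffOn (𝓡 m) (𝓡 4) ∞ f U) (hU : IsOpen U)
    {X Y : M → EuclideanSpace ℝ (Fin m)} (hX : SmoothOn U X) (hY : SmoothOn U Y) {x : M}
    (hx : x ∈ U) :
    covAlong g f (fun y ↦ dmap f y (Y y)) x (X x) - covAlong g f (fun y ↦ dmap f y (X y)) x (Y x)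
      = dmap f x (bracket m X Y x) := by
  have hp := mem_extChartAt_source (I := 𝓡 4) (f x)
  have hW : IsOpen (U ∩ f ⁻¹' (extChartAt (𝓡 4) (f x)).source) :=
    hf.continuousOn.isOpen_inter_preimage hU (isOpen_extChartAt_source _)
  set O := U ∩ f ⁻¹' (extChartAt (𝓡 4) (f x)).source
  have hxO : x ∈ O := ⟨hx, mem_extChartAt_source _⟩
  have hc : ContMDiffOn (𝓡 m) 𝓘(ℝ, E4) ∞ (chartMap (f x) f) O := fun y hy ↦
    (contMDiffAt_chartMap (hf.contMDiffAt (hU.mem_nhds hy.1)) hy.2).contMDiffWithinAt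
  have key (X : M → EuclideanSpace ℝ (Fin m)) : chartSec (f x) f (fun y ↦ dmap f y (X y))
      =ᶠ[𝓝 x] fun y ↦ dfun m (chartMap (f x) f) y (X y) := by
    filter_upwards [hW.mem_nhds hxO] with y hy
    exact (dfun_chartMap (mdifferentiableAt_of_contMDiffOn hU hf hy.1) hy.2 _).symm
  have hd : dmap f x (bracket m X Y x) = dfun m (chartMap (f x) f) x (bracket m X Y x) :=
    (dfun_chartMap_self (mdifferentiableAt_of_contMDiffOn hU hf hx) _).symm
  rw [covAlong, covAlong, dfun_congr (key X), dfun_congr (key Y), hd,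
    dfun_bracket hW hc (hX.mono Set.inter_subset_left) (hY.mono Set.inter_subset_left) hxO]
  have hs := christoffelOf_symm
    ((LorentzMetric.contDiffAt_inChart (g := g) hp).differentiableAt (by simp))
    (LorentzMetric.eventually_inChart_symm hp) (dmap f x (X x)) (dmap f x (Y x))
  change christoffelOf (g.inChart (f x)) (chartMap (f x) f x) _ _ =
    christoffelOf (g.inChart (f x)) (chartMap (f x) f x) _ _ at hs
  rw [hs]
  abel

/-- The curvature of the connection along `f`. -/
noncomputable def curvAlong (g : LorentzMetric V) (f : M → V) (X Y : M → EuclideanSpace ℝ (Fin m))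
    (Z : M → E4) (x : M) : E4 :=
  covAlong g f (fun y ↦ covAlong g f Z y (Y y)) x (X x)
    - covAlong g f (fun y ↦ covAlong g f Z y (X y)) x (Y x) - covAlong g f Z x (bracket m X Y x)

/-- The Riemann tensor, in terms of the Christoffel symbols in the preferred chart. -/
noncomputable def riemannInChart (g : LorentzMetric V) (p : V) (v w z : E4) : E4 :=
  fderiv ℝ (christoffelOf (g.inChart p)) (extChartAt (𝓡 4) p p) v w z
    - fderiv ℝ (christoffelOf (g.inChart p)) (extChartAt (𝓡 4) p p) w v z
    + christoffelOf (g.inChart p) (extChartAt (𝓡 4) p p) v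
      (christoffelOf (g.inChart p) (extChartAt (𝓡 4) p p) w z)
    - christoffelOf (g.inChart p) (extChartAt (𝓡 4) p p) w
      (christoffelOf (g.inChart p) (extChartAt (𝓡 4) p p) v z)

/-- In the chart at `f x`, the terms with derivatives of `X`, `Y` or `Z` are either symmetric under
exchange of `X` and `Y` or absorbed by the bracket. What is left involves only values at `x`, whence
tensoriality; and it does not see `f` except through its differential, so surfaces and the ambient
space share one Riemann tensor. -/
theorem curvAlong_eq (hZ : SmoothAlong m f U Z) (hU : IsOpen U)
    {X Y : M → EuclideanSpace ℝ (Fin m)} (hX : SmoothOn U X) (hY : SmoothOn U Y) {x : M}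
    (hx : x ∈ U) :
    curvAlong g f X Y Z x = riemannInChart g (f x) (dmap f x (X x)) (dmap f x (Y x)) (Z x) := by
  have hp := mem_extChartAt_source (I := 𝓡 4) (f x)
  have hf := hZ.base
  have hfx := mdifferentiableAt_of_contMDiffOn hU hf hx
  have hO : IsOpen (U ∩ f ⁻¹' (extChartAt (𝓡 4) (f x)).source) :=
    hf.continuousOn.isOpen_inter_preimage hU (isOpen_extChartAt_source _)
  set O := U ∩ f ⁻¹' (extChartAt (𝓡 4) (f x)).source
  have hxO : x ∈ O := ⟨hx, mem_extChartAt_source _⟩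
  set c := chartMap (f x) f with hcdef
  set z := chartSec (f x) f Z with hzdef
  set Γ := christoffelOf (g.inChart (f x)) with hΓdef
  have hc : ContMDiffOn (𝓡 m) 𝓘(ℝ, E4) ∞ c O := fun y hy ↦
    (contMDiffAt_chartMap (hf.contMDiffAt (hU.mem_nhds hy.1)) hy.2).contMDiffWithinAt
  have hz : ContMDiffOn (𝓡 m) 𝓘(ℝ, E4) ∞ z O := fun y hy ↦
    (hZ.contMDiffAt_chartSec hU hy.1 hy.2).contMDiffWithinAt
  have hXO := hX.mono (t := O) Set.inter_subset_left
  have hYO := hY.mono (t := O) Set.inter_subset_left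
  have hΓ : DifferentiableAt ℝ Γ (c x) :=
    (contDiffAt_christoffelOf (LorentzMetric.contDiffAt_inChart hp)
      (LorentzMetric.isInvertible_inChart hp)).differentiableAt (by simp)
  have md {F : Type} [NormedAddCommGroup F] [NormedSpace ℝ F] {h : M → F}
      (hh : ContMDiffOn (𝓡 m) 𝓘(ℝ, F) ∞ h O) : MDifferentiableAt (𝓡 m) 𝓘(ℝ, F) h x :=
    mdifferentiableAt_of_contMDiffOn hO hh hxO
  have hΓc : MDifferentiableAt (𝓡 m) 𝓘(ℝ, E4 →L[ℝ] E4 →L[ℝ] E4) (fun y ↦ Γ (c y)) x :=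
    (contMDiffAt_christoffelOf_chartMap (hc.contMDiffAt (hO.mem_nhds hxO))).mdifferentiableAt
      (by simp)
  have key (X Y : M → EuclideanSpace ℝ (Fin m)) (hX : SmoothOn O X) (hY : SmoothOn O Y) :
      covAlong g f (fun y ↦ covAlong g f Z y (Y y)) x (X x)
        = dfun m (fun y ↦ dfun m z y (Y y)) x (X x)
          + (fderiv ℝ Γ (c x) (dmap f x (X x)) (dmap f x (Y x)) (Z x)
            + Γ (c x) (dfun m (fun y ↦ dfun m c y (Y y)) x (X x)) (Z x)
            + Γ (c x) (dmap f x (Y x)) (dfun m z x (X x)))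
          + Γ (c x) (dmap f x (X x)) (dfun m z x (Y x) + Γ (c x) (dmap f x (Y x)) (Z x)) := by
    have h1 : chartSec (f x) f (fun y ↦ covAlong g f Z y (Y y)) =ᶠ[𝓝 x] fun y ↦
        dfun m z y (Y y) + Γ (c y) (dfun m c y (Y y)) (z y) := by
      filter_upwards [hO.mem_nhds hxO] with y hy
      exact toChart_covAlong hZ hU hy.1 hy.2 _
    have hdc := md (contMDiffOn_dfun_apply hO hc hY)
    rw [covAlong, dfun_congr h1, dfun_add (md (contMDiffOn_dfun_apply hO hz hY))
      ((hΓc.clm_apply hdc).clm_apply (md hz)),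
      dfun_clm_apply (hΓc.clm_apply hdc) (md hz), dfun_clm_apply hΓc hdc, dfun_comp hΓ (md hc)]
    have hcx (v) : dfun m c x v = dmap f x v := dfun_chartMap_self hfx v
    have hzx : z x = Z x := chartSec_self x
    simp only [hcx, hzx, covAlong, add_apply]
    rfl
  have h2 : covAlong g f Z x (bracket m X Y x) = dfun m z x (bracket m X Y x)
      + Γ (c x) (dfun m c x (bracket m X Y x)) (Z x) := by
    rw [hcdef, dfun_chartMap_self hfx]
    rfl
  rw [curvAlong, key X Y hXO hYO, key Y X hYO hXO, h2, dfun_bracket hO hz hXO hYO hxO,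
    dfun_bracket hO hc hXO hYO hxO]
  change _ = fderiv ℝ Γ (c x) _ _ _ - fderiv ℝ Γ (c x) _ _ _ + Γ (c x) _ (Γ (c x) _ _)
    - Γ (c x) _ (Γ (c x) _ _)
  simp only [map_add, map_sub, sub_apply]
  abel

end AlongMapIdentities

/-! ### Comparison with the original definitions of connection and curvature. -/

section Bridge

set_option maxSynthPendingDepth 3

variable {V : Type*} [TopologicalSpace V] [ChartedSpace E4 V] [IsManifold (𝓡 4) ∞ V]
variable {g : LorentzMetric V}

theorem nablaAlong_eq {S : Type*} [TopologicalSpace S] [ChartedSpace E2 S]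
    [IsManifold (𝓡 2) ∞ S] (Φ : S → V) (Z : S → E4) (x : S) (v : E2) :
    nablaAlong g Φ Z x v = covAlong g Φ Z x v := by
  change partialDerivAlong Φ Z x v + g.christoffel (Φ x) (diff Φ x v) (Z x) = _
  exact congrArg (partialDerivAlong Φ Z x v + ·) (g.christoffel_eq _ _ _)

omit [IsManifold (𝓡 4) ∞ V] in
theorem dmap_id (p : V) (v : E4) : dmap (m := 4) (id : V → V) p v = v := by
  have := mfderiv_id (I := 𝓡 4) (x := p)
  exact congrArg (fun L : E4 →L[ℝ] E4 ↦ L v) this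

theorem nabla_eq (Z : V → E4) (p : V) (v : E4) : g.nabla Z p v = covAlong g (id : V → V) Z p v := by
  change LorentzMetric.partialDeriv Z p v + g.christoffel p v (Z p) = _
  rw [covAlong, dmap_id]
  exact congrArg (LorentzMetric.partialDeriv Z p v + ·) (g.christoffel_eq _ _ _)

theorem smoothAlong_id {U : Set V} {Z : V → E4} (h : SmoothOn (m := 4) U Z) :
    SmoothAlong 4 (id : V → V) U Z := h

theorem exists_smoothOn_extend {m : ℕ} {M : Type*} [TopologicalSpace M]
    [ChartedSpace (EuclideanSpace ℝ (Fin m)) M] [IsManifold (𝓡 m) ∞ M] (x : M)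
    (v : EuclideanSpace ℝ (Fin m)) :
    ∃ X : M → EuclideanSpace ℝ (Fin m), X x = v ∧
      X = FiberBundle.extend (E := TangentSpace (𝓡 m)) (EuclideanSpace ℝ (Fin m)) (x := x) v ∧
      ∃ U : Set M, IsOpen U ∧ x ∈ U ∧ SmoothOn U X := by
  obtain ⟨s, hs, h⟩ := FiberBundle.exists_contMDiffOn_extend (I := 𝓡 m) (k := ∞)
    (V := (TangentSpace (𝓡 m) : M → Type _)) (EuclideanSpace ℝ (Fin m)) (x₀ := x) v
  obtain ⟨U, hUs, hU, hxU⟩ := mem_nhds_iff.1 hs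
  exact ⟨_, FiberBundle.extend_apply_self (E := (TangentSpace (𝓡 m) : M → Type _)) _ _, rfl, U, hU,
    hxU, h.mono hUs⟩

/-- A vector field on the ambient space is a field along the identity map. The extensions in the
definition of `riemann` are smooth only near `p`, which is enough for `curvAlong_eq`. -/
theorem riemann_eq (p : V) (v w z : E4) : g.riemann p v w z = riemannInChart g p v w z := by
  obtain ⟨X, hXp, hX, U₁, hU₁, hp₁, hX'⟩ := exists_smoothOn_extend (m := 4) p v
  obtain ⟨Y, hYp, hY, U₂, hU₂, hp₂, hY'⟩ := exists_smoothOn_extend (m := 4) p w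
  obtain ⟨Z, hZp, hZ, U₃, hU₃, hp₃, hZ'⟩ := exists_smoothOn_extend (m := 4) p z
  have h : g.riemann p v w z = curvAlong g (id : V → V) X Y Z p := by
    have h1 : g.riemann p v w z = g.curvatureField X Y Z p := by rw [hX, hY, hZ]; rfl
    have e (Y : V → E4) : (fun q ↦ g.nabla Z q (Y q)) = fun q ↦ covAlong g (id : V → V) Z q (Y q) :=
      funext fun q ↦ nabla_eq Z q (Y q)
    have e2 (X Y : V → E4) : g.nabla (fun q ↦ g.nabla Z q (Y q)) p (X p)
        = covAlong g (id : V → V) (fun q ↦ covAlong g (id : V → V) Z q (Y q)) p (X p) := by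
      rw [← e]
      exact nabla_eq _ p (X p)
    rw [h1, curvAlong, ← e2, ← e2, ← nabla_eq]
    rfl
  have h2 := curvAlong_eq (g := g) (U := U₁ ∩ (U₂ ∩ U₃)) (x := p)
    (smoothAlong_id (hZ'.mono (fun y hy ↦ hy.2.2))) (hU₁.inter (hU₂.inter hU₃))
    (hX'.mono (fun y hy ↦ hy.1)) (hY'.mono (fun y hy ↦ hy.2.1)) ⟨hp₁, hp₂, hp₃⟩
  rw [h, h2, dmap_id, dmap_id, hXp, hYp, hZp]
  rfl

end Bridge

/-! ### First fundamental form, tangential and normal parts. -/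

section SurfaceBasics

set_option linter.unusedSectionVars false

variable {V : Type*} [TopologicalSpace V] [ChartedSpace E4 V] [IsManifold (𝓡 4) ∞ V]
variable {S : Type*} [TopologicalSpace S] [ChartedSpace E2 S] [IsManifold (𝓡 2) ∞ S]
variable {g : LorentzMetric V} {Φ : S → V}

/-- The first fundamental form on components. -/
noncomputable def indForm (g : LorentzMetric V) (Φ : S → V) (x : S) (v w : E2) : ℝ :=
  g.form (Φ x) (dmap Φ x v) (dmap Φ x w)

/-- The tangential part on components. -/
noncomputable def tanPart (g : LorentzMetric V) (Φ : S → V) (x : S) (ξ : E4) : E2 :=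
  tangentPart g Φ x ξ

/-- The normal part on components. -/
noncomputable def norPart (g : LorentzMetric V) (Φ : S → V) (x : S) (ξ : E4) : E4 :=
  normalPart g Φ x ξ

/-- Orthogonality to the surface on components. -/
def IsNor (g : LorentzMetric V) (Φ : S → V) (x : S) (ξ : E4) : Prop :=
  ∀ v : E2, g.form (Φ x) ξ (dmap Φ x v) = 0

theorem norPart_eq (x : S) (ξ : E4) : norPart g Φ x ξ = ξ - dmap Φ x (tanPart g Φ x ξ) := rfl

theorem indForm_pos (hΦ : IsSpacelikeImmersion g Φ) (x : S) {v : E2} (hv : v ≠ 0) :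
    0 < indForm g Φ x v v := hΦ.spacelike x v hv

theorem indForm_symm (x : S) (v w : E2) : indForm g Φ x v w = indForm g Φ x w v := g.form_symm _ _ _

theorem indForm_nondegenerate (hΦ : IsSpacelikeImmersion g Φ) (x : S) {v w : E2}
    (h : ∀ u, indForm g Φ x v u = indForm g Φ x w u) : v = w := by
  by_contra hne
  have h1 := indForm_pos hΦ x (sub_ne_zero.2 hne)
  have h2 := h (v - w)
  simp only [indForm, map_sub, sub_apply] at h1 h2
  linarith

theorem indForm_tanPart (hΦ : IsSpacelikeImmersion g Φ) (x : S) (ξ : E4) (v : E2) :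
    indForm g Φ x (tanPart g Φ x ξ) v = g.form (Φ x) ξ (dmap Φ x v) := by
  let B : E2 →L[ℝ] E2 →L[ℝ] ℝ :=
    (ContinuousLinearMap.precomp ℝ (dmap Φ x)).comp ((g.form (Φ x)).comp (dmap Φ x))
  have hB : ∀ v w, B v w = indForm g Φ x v w := fun v w ↦ rfl
  have hi : B.IsInvertible := isInvertible_of_nondegenerate fun v hv ↦
    indForm_nondegenerate hΦ x (w := 0) fun u ↦ by
      rw [← hB, hv]
      simp [indForm]
  have h1 := hi.self_apply_inverse ((g.form (Φ x) ξ).comp (dmap Φ x))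
  exact congrArg (fun L : E2 →L[ℝ] ℝ ↦ L v) h1

theorem tanPart_unique (hΦ : IsSpacelikeImmersion g Φ) {x : S} {ξ : E4} {w : E2}
    (h : ∀ v, indForm g Φ x w v = g.form (Φ x) ξ (dmap Φ x v)) : tanPart g Φ x ξ = w :=
  indForm_nondegenerate hΦ x fun u ↦ by rw [indForm_tanPart hΦ, h]

theorem isNor_norPart (hΦ : IsSpacelikeImmersion g Φ) (x : S) (ξ : E4) :
    IsNor g Φ x (norPart g Φ x ξ) := fun v ↦ by
  have := indForm_tanPart hΦ x ξ v
  rw [indForm] at this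
  rw [norPart_eq, map_sub, sub_apply, this, sub_self]

theorem form_norPart {x : S} (ξ : E4) {η : E4} (hη : IsNor g Φ x η) :
    g.form (Φ x) (norPart g Φ x ξ) η = g.form (Φ x) ξ η := by
  rw [norPart_eq, map_sub, sub_apply, g.form_symm _ (dmap Φ x _), hη, sub_zero]

theorem IsNor.norPart_eq_self (hΦ : IsSpacelikeImmersion g Φ) {x : S} {ξ : E4}
    (h : IsNor g Φ x ξ) : norPart g Φ x ξ = ξ := by
  have : tanPart g Φ x ξ = 0 := tanPart_unique hΦ fun v ↦ by rw [h v]; simp [indForm]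
  rw [norPart_eq, this, map_zero, sub_zero]

theorem IsNor.ext (hΦ : IsSpacelikeImmersion g Φ) {x : S} {ξ η : E4} (hξ : IsNor g Φ x ξ)
    (hη : IsNor g Φ x η) (h : ∀ ν, IsNor g Φ x ν → g.form (Φ x) ξ ν = g.form (Φ x) η ν) : ξ = η := by
  rw [← sub_eq_zero]
  refine g.nondegenerate (Φ x) _ fun w ↦ ?_
  change g.form (Φ x) (ξ - η) w = 0
  have h1 : w = norPart g Φ x w + dmap Φ x (tanPart g Φ x w) := by rw [norPart_eq]; abel
  rw [h1, map_add, map_sub, sub_apply, sub_apply, hξ, hη, h _ (isNor_norPart hΦ x w)]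
  ring

theorem IsNor.lin {x : S} {ξ η : E4} (hξ : IsNor g Φ x ξ) (hη : IsNor g Φ x η) (a b : ℝ) :
    IsNor g Φ x (a • ξ + b • η) := fun v ↦ by
  simp [hξ v, hη v]

/-- Orthogonal expansion in the tangent plane. -/
theorem indForm_expand (hΦ : IsSpacelikeImmersion g Φ) (x : S) {p q : E2} (hp : p ≠ 0) (hq : q ≠ 0)
    (hpq : indForm g Φ x p q = 0) (v : E2) :
    v = (indForm g Φ x v p / indForm g Φ x p p) • p + (indForm g Φ x v q / indForm g Φ x q q) • q := by
  have hpp := indForm_pos hΦ x hp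
  have hqq := indForm_pos hΦ x hq
  have hqp : indForm g Φ x q p = 0 := by rw [indForm_symm, hpq]
  have hli : LinearIndependent ℝ ![p, q] := by
    rw [LinearIndependent.pair_iff]
    intro s t hst
    have h1 : indForm g Φ x (s • p + t • q) p = 0 := by rw [hst]; simp [indForm]
    have h2 : indForm g Φ x (s • p + t • q) q = 0 := by rw [hst]; simp [indForm]
    have e1 : indForm g Φ x (s • p + t • q) p = s * indForm g Φ x p p + t * indForm g Φ x q p := by
      simp [indForm]
    have e2 : indForm g Φ x (s • p + t • q) q = s * indForm g Φ x p q + t * indForm g Φ x q q := by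
      simp [indForm]
    rw [e1, hqp] at h1
    rw [e2, hpq] at h2
    constructor
    · simpa [hpp.ne'] using h1
    · simpa [hqq.ne'] using h2
  have hspan := hli.span_eq_top_of_card_eq_finrank' (by simp)
  have hv : v ∈ Submodule.span ℝ (Set.range ![p, q]) := by rw [hspan]; trivial
  rw [Matrix.range_cons, Matrix.range_cons, Matrix.range_empty, Set.union_empty,
    Set.singleton_union, Submodule.mem_span_pair] at hv
  obtain ⟨a, b, rfl⟩ := hv
  have e1 : indForm g Φ x (a • p + b • q) p = a * indForm g Φ x p p + b * indForm g Φ x q p := by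
    simp [indForm]
  have e2 : indForm g Φ x (a • p + b • q) q = a * indForm g Φ x p q + b * indForm g Φ x q q := by
    simp [indForm]
  rw [e1, e2, hqp, hpq]
  simp [hpp.ne', hqq.ne']

theorem contMDiffOn_indForm (hΦ : IsSpacelikeImmersion g Φ) {U : Set S} (hU : IsOpen U) {X Y : S → E2}
    (hX : SmoothOn U X) (hY : SmoothOn U Y) :
    ContMDiffOn (𝓡 2) 𝓘(ℝ, ℝ) ∞ (fun y ↦ indForm g Φ y (X y) (Y y)) U :=
  (smoothAlong_dmap hΦ.contMDiff.contMDiffOn hU hX).form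
    (smoothAlong_dmap hΦ.contMDiff.contMDiffOn hU hY) hU

theorem SmoothOn.sub {U : Set S} {X Y : S → E2} (hX : SmoothOn U X) (hY : SmoothOn U Y) :
    SmoothOn U (fun y ↦ X y - Y y) := ContMDiffOn.sub_section hX hY

theorem SmoothOn.smul {U : Set S} {a : S → ℝ} {X : S → E2}
    (ha : ContMDiffOn (𝓡 2) 𝓘(ℝ, ℝ) ∞ a U) (hX : SmoothOn U X) :
    SmoothOn U (fun y ↦ a y • X y) := ContMDiffOn.smul_section ha hX

/-- The Gram-Schmidt step, without normalization. -/
noncomputable def orthField (g : LorentzMetric V) (Φ : S → V) (X Y : S → E2) (y : S) : E2 :=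
  indForm g Φ y (X y) (X y) • Y y - indForm g Φ y (X y) (Y y) • X y

theorem indForm_orthField (X Y : S → E2) (y : S) :
    indForm g Φ y (X y) (orthField g Φ X Y y) = 0 := by
  simp [orthField, indForm]
  ring

theorem SmoothOn.orthField (hΦ : IsSpacelikeImmersion g Φ) {U : Set S} (hU : IsOpen U) {X Y : S → E2}
    (hX : SmoothOn U X) (hY : SmoothOn U Y) : SmoothOn U (orthField g Φ X Y) :=
  SmoothOn.sub (SmoothOn.smul (contMDiffOn_indForm hΦ hU hX hX) hY)
    (SmoothOn.smul (contMDiffOn_indForm hΦ hU hX hY) hX)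

/-- Around every point there are orthogonal tangent fields spanning the tangent planes. -/
theorem exists_orthogonal_fields (hΦ : IsSpacelikeImmersion g Φ) (x : S) :
    ∃ X Y : S → E2, ∃ U : Set S, IsOpen U ∧ x ∈ U ∧ SmoothOn U X ∧ SmoothOn U Y ∧
      ∀ y ∈ U, indForm g Φ y (X y) (Y y) = 0 ∧ X y ≠ 0 ∧ Y y ≠ 0 := by
  obtain ⟨X, hXx, -, U₁, hU₁, hx₁, hX⟩ := exists_smoothOn_extend x (EuclideanSpace.single 0 1 : E2)
  obtain ⟨Y, hYx, -, U₂, hU₂, hx₂, hY⟩ := exists_smoothOn_extend x (EuclideanSpace.single 1 1 : E2)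
  have hU := hU₁.inter hU₂
  have hX' := hX.mono (t := U₁ ∩ U₂) Set.inter_subset_left
  have hY' := hY.mono (t := U₁ ∩ U₂) Set.inter_subset_right
  have hW : SmoothOn (U₁ ∩ U₂) (orthField g Φ X Y) := SmoothOn.orthField hΦ hU hX' hY'
  have hXx0 : X x ≠ 0 := by rw [hXx]; simp
  have hWx0 : orthField g Φ X Y x ≠ 0 := by
    intro h
    -- With X = e₀ and Y = e₁ at `x`, the coordinate of index 1 of the orthogonalized field is the
    -- square of X, which is positive.
    have h1 := congrArg (fun v : E2 ↦ v 1) h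
    simp [orthField, hXx, hYx] at h1
    rw [← hXx] at h1
    exact (indForm_pos hΦ x hXx0).ne' h1
  have c1 := (contMDiffOn_indForm hΦ hU hX' hX').continuousOn
  have c2 := (contMDiffOn_indForm hΦ hU hW hW).continuousOn
  have o1 := c1.isOpen_inter_preimage hU (isOpen_Ioi (a := (0 : ℝ)))
  have o2 := c2.isOpen_inter_preimage hU (isOpen_Ioi (a := (0 : ℝ)))
  refine ⟨X, orthField g Φ X Y, _, o1.inter o2, ⟨⟨⟨hx₁, hx₂⟩, indForm_pos hΦ x hXx0⟩,
    ⟨⟨hx₁, hx₂⟩, indForm_pos hΦ x hWx0⟩⟩, hX'.mono fun y hy ↦ hy.1.1, hW.mono fun y hy ↦ hy.1.1,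
    fun y hy ↦ ⟨indForm_orthField _ _ _, ?_, ?_⟩⟩
  · intro h
    have : (0 : ℝ) < indForm g Φ y (X y) (X y) := hy.1.2
    simp [h, indForm] at this
  · intro h
    have : (0 : ℝ) < indForm g Φ y (orthField g Φ X Y y) (orthField g Φ X Y y) := hy.2.2
    simp [h, indForm] at this

/-- The normal part is defined pointwise through an inverse. Near each point it equals `Z` minus its
projections on an orthogonal tangent frame, an expression that is visibly smooth. -/
theorem SmoothAlong.norPart (hΦ : IsSpacelikeImmersion g Φ) {U : Set S} (hU : IsOpen U) {Z : S → E4}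
    (hZ : SmoothAlong 2 Φ U Z) : SmoothAlong 2 Φ U (fun y ↦ norPart g Φ y (Z y)) := by
  intro x hx
  obtain ⟨X, Y, O, hO, hxO, hX, hY, hXY⟩ := exists_orthogonal_fields hΦ x
  have hUO := hU.inter hO
  have hX' : SmoothAlong 2 Φ (U ∩ O) _ := smoothAlong_dmap hΦ.contMDiff.contMDiffOn hUO
    (hX.mono Set.inter_subset_right)
  have hY' : SmoothAlong 2 Φ (U ∩ O) _ := smoothAlong_dmap hΦ.contMDiff.contMDiffOn hUO
    (hY.mono Set.inter_subset_right)
  have hZ' : SmoothAlong 2 Φ (U ∩ O) Z := hZ.mono Set.inter_subset_left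
  have cX := (hZ'.form (g := g) hX' hUO).div₀ (hX'.form (g := g) hX' hUO) fun y hy ↦
    (indForm_pos hΦ y (hXY y hy.2).2.1).ne'
  have cY := (hZ'.form (g := g) hY' hUO).div₀ (hY'.form (g := g) hY' hUO) fun y hy ↦
    (indForm_pos hΦ y (hXY y hy.2).2.2).ne'
  have h1 := hZ'.sub ((SmoothAlong.smul cX hX' hUO).add (SmoothAlong.smul cY hY' hUO) hUO) hUO
  refine ((h1.contMDiffAt (hUO.mem_nhds ⟨hx, hxO⟩)).congr_of_eventuallyEq ?_).contMDiffWithinAt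
  filter_upwards [hUO.mem_nhds ⟨hx, hxO⟩] with y hy
  obtain ⟨h0, hX0, hY0⟩ := hXY y hy.2
  congr 1
  have h2 := indForm_expand hΦ y hX0 hY0 h0 (tanPart g Φ y (Z y))
  rw [indForm_tanPart hΦ, indForm_tanPart hΦ] at h2
  rw [norPart_eq, h2, map_add, map_smul, map_smul]
  rfl

end SurfaceBasics

/-! ### Extension of single vectors to global smooth fields. -/

section Extension

set_option linter.unusedSectionVars false
set_option maxSynthPendingDepth 3

variable {V : Type*} [TopologicalSpace V] [ChartedSpace E4 V] [IsManifold (𝓡 4) ∞ V]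
variable {S : Type*} [TopologicalSpace S] [ChartedSpace E2 S] [IsManifold (𝓡 2) ∞ S]
variable {g : LorentzMetric V} {Φ : S → V}

/-- The conditions of the theorem quantify over global fields; a bump function, available on a
Hausdorff surface, makes them reach every vector at `x`. -/
theorem exists_tangentField [T2Space S] (x : S) (v : E2) :
    ∃ X : S → E2, SmoothOn Set.univ X ∧ X x = v := by
  obtain ⟨X, hXx, -, U, hU, hxU, hX⟩ := exists_smoothOn_extend x v
  obtain ⟨ρ, -, hρ⟩ := (SmoothBumpFunction.nhds_basis_tsupport (I := 𝓡 2) x).mem_iff.1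
    (hU.mem_nhds hxU)
  have h := ContMDiffOn.smul_section_of_tsupport (ψ := ρ) (ρ.contMDiff.contMDiffOn (s := U)) hU hρ hX
  refine ⟨fun y ↦ ρ y • X y, h.contMDiffOn, ?_⟩
  change ρ x • X x = v
  rw [ρ.eq_one, one_smul, hXx]

theorem smoothAlong_zero {m : ℕ} {M : Type*} [TopologicalSpace M]
    [ChartedSpace (EuclideanSpace ℝ (Fin m)) M] {f : M → V} {U : Set M} (hU : IsOpen U)
    (hf : ContMDiffOn (𝓡 m) (𝓡 4) ∞ f U) : SmoothAlong m f U (fun _ ↦ 0) :=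
  smoothAlong_of_chartSec hU hf fun x _ ↦ by
    have h : chartSec (f x) f (fun _ ↦ (0 : E4)) = fun _ ↦ 0 := by
      ext1 y
      simp [chartSec]
    rw [h]
    exact contMDiffAt_const

/-- Smooth normal fields on a subset. -/
def NorOn (g : LorentzMetric V) (Φ : S → V) (U : Set S) (N : S → E4) : Prop :=
  SmoothAlong 2 Φ U N ∧ ∀ y ∈ U, IsNor g Φ y (N y)

/-- Extend `ξ` near `Φ x` in the ambient space, restrict to the surface, cut off with a bump
function and project to the normal planes; the projection fixes `ξ` at `x`. -/
theorem exists_normalField [T2Space S] (hΦ : IsSpacelikeImmersion g Φ) (x : S) {ξ : E4}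
    (hξ : IsNor g Φ x ξ) : ∃ N : S → E4, NorOn g Φ Set.univ N ∧ N x = ξ := by
  obtain ⟨Z, hZx, -, O, hO, hxO, hZ⟩ := exists_smoothOn_extend (m := 4) (Φ x) ξ
  set U := Φ ⁻¹' O with hUdef
  have hU : IsOpen U := hO.preimage hΦ.contMDiff.continuous
  have hxU : x ∈ U := hxO
  have hZΦ : SmoothAlong 2 Φ U (fun y ↦ Z (Φ y)) :=
    ContMDiffOn.comp (g := fun q ↦ (⟨q, Z q⟩ : TangentBundle (𝓡 4) V)) hZ
      (hΦ.contMDiff.contMDiffOn (s := U)) fun y hy ↦ hy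
  obtain ⟨ρ, -, hρ⟩ := (SmoothBumpFunction.nhds_basis_tsupport (I := 𝓡 2) x).mem_iff.1
    (hU.mem_nhds hxU)
  have h1 : SmoothAlong 2 Φ U (fun y ↦ ρ y • Z (Φ y)) :=
    SmoothAlong.smul ρ.contMDiff.contMDiffOn hZΦ hU
  have hc : IsOpen (tsupport ρ)ᶜ := isOpen_compl_iff.2 (isClosed_tsupport ρ)
  have h2 : SmoothAlong 2 Φ (tsupport ρ)ᶜ (fun y ↦ ρ y • Z (Φ y)) := by
    refine (smoothAlong_zero hc hΦ.contMDiff.contMDiffOn).congr fun y hy ↦ ?_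
    have : ρ y = 0 := image_eq_zero_of_notMem_tsupport hy
    simp [this]
  have h3 : SmoothAlong 2 Φ Set.univ (fun y ↦ ρ y • Z (Φ y)) := by
    have := contMDiff_of_contMDiffOn_union_of_isOpen h1 h2 (by
      rw [Set.eq_univ_iff_forall]
      intro y
      by_cases hy : y ∈ tsupport ρ
      · exact Or.inl (hρ hy)
      · exact Or.inr hy) hU hc
    exact this.contMDiffOn
  refine ⟨_, ⟨h3.norPart hΦ isOpen_univ, fun y _ ↦ isNor_norPart hΦ y _⟩, ?_⟩
  rw [ρ.eq_one, one_smul, hZx, hξ.norPart_eq_self hΦ]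

theorem NorOn.mono {U U' : Set S} {N : S → E4} (h : NorOn g Φ U N) (hU : U' ⊆ U) :
    NorOn g Φ U' N :=
  ⟨ContMDiffOn.mono h.1 hU, fun y hy ↦ h.2 y (hU hy)⟩

end Extension

/-! ### Weingarten operators, normal connection and the Ricci equation. -/

section Weingarten

set_option linter.unusedSectionVars false
set_option maxSynthPendingDepth 3

variable {V : Type*} [TopologicalSpace V] [ChartedSpace E4 V] [IsManifold (𝓡 4) ∞ V]
variable {S : Type*} [TopologicalSpace S] [ChartedSpace E2 S] [IsManifold (𝓡 2) ∞ S]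
variable {g : LorentzMetric V} {Φ : S → V} {U : Set S} {N M : S → E4} {x : S}

/-- If two fields along `Φ` are orthogonal, differentiation can be moved from one to the other. -/
theorem form_covAlong_of_orthogonal {Z W : S → E4} (hU : IsOpen U) (hx : x ∈ U)
    (hZ : SmoothAlong 2 Φ U Z) (hW : SmoothAlong 2 Φ U W)
    (h : ∀ y ∈ U, g.form (Φ y) (Z y) (W y) = 0) (v : E2) :
    g.form (Φ x) (covAlong g Φ Z x v) (W x) = - g.form (Φ x) (Z x) (covAlong g Φ W x v) := by
  have h1 := dfun_form (g := g) hZ hW hU hx v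
  have h2 : (fun y ↦ g.form (Φ y) (Z y) (W y)) =ᶠ[𝓝 x] fun _ ↦ (0 : ℝ) := by
    filter_upwards [hU.mem_nhds hx] with y hy using h y hy
  rw [dfun_congr h2, dfun_const] at h1
  linarith

/-- The Weingarten operator on components. -/
noncomputable def wein (g : LorentzMetric V) (Φ : S → V) (N : S → E4) (x : S) (v : E2) : E2 :=
  tanPart g Φ x (covAlong g Φ N x v)

/-- The normal connection on components. -/
noncomputable def dnor (g : LorentzMetric V) (Φ : S → V) (N : S → E4) (x : S) (v : E2) : E4 :=
  norPart g Φ x (covAlong g Φ N x v)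

/-- The derivative of a vector field tangent to the surface, extending `w`, in the direction `v`. -/
noncomputable def sff (g : LorentzMetric V) (Φ : S → V) (x : S) (v w : E2) : E4 :=
  covAlong g Φ (fun y ↦ dmap Φ y
    (FiberBundle.extend (E := TangentSpace (𝓡 2)) E2 (x := x) w y : E2)) x v

/-- `N` stays orthogonal to a tangent field extending `w`, so the derivative moves onto that field.
On the right `N` enters only by its value at `x`; linearity of the Weingarten operator in that value
follows. -/
theorem indForm_wein (hΦ : IsSpacelikeImmersion g Φ) (hU : IsOpen U) (hx : x ∈ U)
    (hN : NorOn g Φ U N) (v w : E2) :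
    indForm g Φ x (wein g Φ N x v) w = - g.form (Φ x) (N x) (sff g Φ x v w) := by
  obtain ⟨W, hWx, hWe, O, hO, hxO, hW⟩ := exists_smoothOn_extend x w
  have hUO := hU.inter hO
  have h1 := form_covAlong_of_orthogonal (g := g) hUO ⟨hx, hxO⟩ (hN.mono Set.inter_subset_left).1
    (smoothAlong_dmap hΦ.contMDiff.contMDiffOn hUO (hW.mono Set.inter_subset_right))
    (fun y hy ↦ hN.2 y hy.1 (W y)) v
  rw [wein, indForm_tanPart hΦ, sff, ← hWe]
  rw [hWx] at h1
  exact h1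

/-- Since torsion vanishes, the antisymmetric part is dΦ of a Lie bracket. Being tangential, it is
invisible to normal vectors, and so the Weingarten operators are self-adjoint. -/
theorem sff_sub (hΦ : IsSpacelikeImmersion g Φ) (x : S) (v w : E2) :
    ∃ u : E2, sff g Φ x v w - sff g Φ x w v = dmap Φ x u := by
  obtain ⟨X, hXx, hXe, O, hO, hxO, hX⟩ := exists_smoothOn_extend x v
  obtain ⟨Y, hYx, hYe, O', hO', hxO', hY⟩ := exists_smoothOn_extend x w
  have h := covAlong_dmap (g := g) (U := O ∩ O') (x := x) hΦ.contMDiff.contMDiffOn (hO.inter hO')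
    (hX.mono Set.inter_subset_left) (hY.mono Set.inter_subset_right) ⟨hxO, hxO'⟩
  refine ⟨_, Eq.trans ?_ h⟩
  rw [sff, sff, ← hXe, ← hYe, hXx, hYx]

theorem indForm_wein_symm (hΦ : IsSpacelikeImmersion g Φ) (hU : IsOpen U) (hx : x ∈ U)
    (hN : NorOn g Φ U N) (v w : E2) :
    indForm g Φ x (wein g Φ N x v) w = indForm g Φ x (wein g Φ N x w) v := by
  obtain ⟨u, hu⟩ := sff_sub hΦ x v w
  have h := hN.2 x hx u
  rw [← hu, map_sub] at h
  rw [indForm_wein hΦ hU hx hN, indForm_wein hΦ hU hx hN]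
  linarith

/-- The three fields may have different domains and are related only at `x`, so global fields can be
compared with local frames. -/
theorem wein_lin (hΦ : IsSpacelikeImmersion g Φ) {U₁ U₂ : Set S} (hU : IsOpen U) (hx : x ∈ U)
    (hU₁ : IsOpen U₁) (hx₁ : x ∈ U₁) (hU₂ : IsOpen U₂) (hx₂ : x ∈ U₂) {N₁ N₂ : S → E4}
    (hN : NorOn g Φ U N) (hN₁ : NorOn g Φ U₁ N₁) (hN₂ : NorOn g Φ U₂ N₂) {a b : ℝ}
    (h : N x = a • N₁ x + b • N₂ x) (v : E2) :
    wein g Φ N x v = a • wein g Φ N₁ x v + b • wein g Φ N₂ x v := by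
  refine indForm_nondegenerate hΦ x fun w ↦ ?_
  have h1 : indForm g Φ x (a • wein g Φ N₁ x v + b • wein g Φ N₂ x v) w =
      a * indForm g Φ x (wein g Φ N₁ x v) w + b * indForm g Φ x (wein g Φ N₂ x v) w := by
    simp [indForm]
  rw [h1, indForm_wein hΦ hU hx hN, indForm_wein hΦ hU₁ hx₁ hN₁, indForm_wein hΦ hU₂ hx₂ hN₂, h]
  simp
  ring

theorem wein_eq_of_eq (hΦ : IsSpacelikeImmersion g Φ) {U₁ : Set S} (hU : IsOpen U) (hx : x ∈ U)
    (hU₁ : IsOpen U₁) (hx₁ : x ∈ U₁) {N₁ : S → E4}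
    (hN : NorOn g Φ U N) (hN₁ : NorOn g Φ U₁ N₁) (h : N x = N₁ x) (v : E2) :
    wein g Φ N x v = wein g Φ N₁ x v := by
  have := wein_lin hΦ hU hx hU₁ hx₁ hU₁ hx₁ hN hN₁ hN₁ (a := 1) (b := 0) (by simp [h]) v
  simpa using this

/-- The normal curvature on components. -/
noncomputable def norCurv (g : LorentzMetric V) (Φ : S → V) (X Y : S → E2) (N : S → E4) (x : S) :
    E4 :=
  dnor g Φ (fun y ↦ dnor g Φ N y (Y y)) x (X x) - dnor g Φ (fun y ↦ dnor g Φ N y (X y)) x (Y x)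
    - dnor g Φ N x (bracket 2 X Y x)

theorem weingarten_eq (N : S → E4) (x : S) (v : E2) : weingarten g Φ N x v = wein g Φ N x v :=
  congrArg (tanPart g Φ x) (nablaAlong_eq Φ N x v)

theorem normalConnection_eq (N : S → E4) (x : S) (v : E2) :
    normalConnection g Φ N x v = dnor g Φ N x v :=
  congrArg (norPart g Φ x) (nablaAlong_eq Φ N x v)

theorem normalCurvature_eq (X Y : S → E2) (N : S → E4) (x : S) :
    normalCurvature g Φ X Y N x = norCurv g Φ X Y N x := by
  have e (Y : S → E2) : (fun q ↦ normalConnection g Φ N q (Y q)) = fun q ↦ dnor g Φ N q (Y q) :=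
    funext fun q ↦ normalConnection_eq N q (Y q)
  have e2 (X Y : S → E2) : normalConnection g Φ (fun q ↦ normalConnection g Φ N q (Y q)) x (X x)
      = dnor g Φ (fun q ↦ dnor g Φ N q (Y q)) x (X x) := by
    rw [← e]
    exact normalConnection_eq _ x (X x)
  rw [norCurv, ← e2, ← e2, ← normalConnection_eq]
  rfl

theorem SmoothAlong.dnor (hΦ : IsSpacelikeImmersion g Φ) (hU : IsOpen U) (hN : SmoothAlong 2 Φ U N)
    {X : S → E2} (hX : SmoothOn U X) : SmoothAlong 2 Φ U (fun y ↦ dnor g Φ N y (X y)) :=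
  (hN.cov hU hX).norPart hΦ hU

/-- ∇_Y N differs from D_Y N by the tangential field dΦ(A_N Y), which is orthogonal to `M`. Moving
the outer derivative of that field onto `M` produces the product of Weingarten operators. -/
theorem form_dnor_dnor (hΦ : IsSpacelikeImmersion g Φ) (hU : IsOpen U) (hx : x ∈ U)
    (hN : NorOn g Φ U N) (hM : NorOn g Φ U M) {Y : S → E2} (hY : SmoothOn U Y) (v : E2) :
    g.form (Φ x) (dnor g Φ (fun y ↦ dnor g Φ N y (Y y)) x v) (M x)
      = g.form (Φ x) (covAlong g Φ (fun y ↦ covAlong g Φ N y (Y y)) x v) (M x)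
        + indForm g Φ x (wein g Φ N x (Y x)) (wein g Φ M x v) := by
  have hC : SmoothAlong 2 Φ U (fun y ↦ covAlong g Φ N y (Y y)) := hN.1.cov hU hY
  have hD : SmoothAlong 2 Φ U (fun y ↦ dnor g Φ N y (Y y)) := hN.1.dnor hΦ hU hY
  have hT := hC.sub hD hU
  have hTe (y : S) : covAlong g Φ N y (Y y) - dnor g Φ N y (Y y) = dmap Φ y (wein g Φ N y (Y y)) := by
    rw [dnor, norPart_eq, wein]
    abel
  have h1 := form_covAlong_of_orthogonal (g := g) hU hx hT hM.1 (fun y hy ↦ by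
    rw [hTe, g.form_symm, hM.2 y hy]) v
  rw [covAlong_sub hC hD hU hx, hTe, g.form_symm _ (dmap _ _ _), ← indForm_tanPart hΦ, map_sub,
    sub_apply] at h1
  have h2 : g.form (Φ x) (dnor g Φ (fun y ↦ dnor g Φ N y (Y y)) x v) (M x)
      = g.form (Φ x) (covAlong g Φ (fun y ↦ dnor g Φ N y (Y y)) x v) (M x) :=
    form_norPart _ (hM.2 x hx)
  rw [indForm_symm]
  change _ = _ + indForm g Φ x (tanPart g Φ x (covAlong g Φ M x v)) _
  linarith

/-- The Ricci equation. -/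
theorem form_norCurv (hΦ : IsSpacelikeImmersion g Φ) (hU : IsOpen U) (hx : x ∈ U)
    (hN : NorOn g Φ U N) (hM : NorOn g Φ U M) {X Y : S → E2} (hX : SmoothOn U X)
    (hY : SmoothOn U Y) :
    g.form (Φ x) (norCurv g Φ X Y N x) (M x)
      = g.form (Φ x) (riemannInChart g (Φ x) (dmap Φ x (X x)) (dmap Φ x (Y x)) (N x)) (M x)
        + indForm g Φ x (wein g Φ N x (Y x)) (wein g Φ M x (X x))
        - indForm g Φ x (wein g Φ N x (X x)) (wein g Φ M x (Y x)) := by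
  have h1 := (curvAlong_eq (g := g) hN.1 hU hX hY hx).symm
  have h2 (v : E2) : g.form (Φ x) (dnor g Φ N x v) (M x) = g.form (Φ x) (covAlong g Φ N x v) (M x) :=
    form_norPart _ (hM.2 x hx)
  rw [h1, norCurv, curvAlong]
  simp only [map_sub, sub_apply]
  rw [form_dnor_dnor hΦ hU hx hN hM hY, form_dnor_dnor hΦ hU hx hN hM hX, h2]
  ring

/-- Apply the bracket identity to the function g(Z, Z). By metricity each second derivative is
2g(∇_X∇_Y Z, Z) plus 2g(∇_Y Z, ∇_X Z), and the latter cancels in the commutator. -/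
theorem form_curvAlong_self {Z : S → E4} (hU : IsOpen U)
    (hx : x ∈ U) (hZ : SmoothAlong 2 Φ U Z) {X Y : S → E2} (hX : SmoothOn U X)
    (hY : SmoothOn U Y) : g.form (Φ x) (curvAlong g Φ X Y Z x) (Z x) = 0 := by
  have hk := hZ.form (g := g) hZ hU
  have h1 := dfun_bracket hU hk hX hY hx
  have e (X Y : S → E2) (hX : SmoothOn U X) (hY : SmoothOn U Y) :
      dfun 2 (fun y ↦ dfun 2 (fun y ↦ g.form (Φ y) (Z y) (Z y)) y (Y y)) x (X x)
        = 2 * (g.form (Φ x) (covAlong g Φ (fun y ↦ covAlong g Φ Z y (Y y)) x (X x)) (Z x)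
          + g.form (Φ x) (covAlong g Φ Z x (Y x)) (covAlong g Φ Z x (X x))) := by
    have hC : SmoothAlong 2 Φ U (fun y ↦ covAlong g Φ Z y (Y y)) := hZ.cov hU hY
    have e1 : (fun y ↦ dfun 2 (fun y ↦ g.form (Φ y) (Z y) (Z y)) y (Y y)) =ᶠ[𝓝 x] fun y ↦
        g.form (Φ y) (covAlong g Φ Z y (Y y)) (Z y) + g.form (Φ y) (covAlong g Φ Z y (Y y)) (Z y) := by
      filter_upwards [hU.mem_nhds hx] with y hy
      rw [dfun_form hZ hZ hU hy, g.form_symm _ (Z y)]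
    have d := mdifferentiableAt_of_contMDiffOn hU (hC.form (g := g) hZ hU) hx
    rw [dfun_congr e1, dfun_add d d, dfun_form hC hZ hU hx]
    ring
  rw [e X Y hX hY, e Y X hY hX, dfun_form hZ hZ hU hx, g.form_symm _ (Z x),
    g.form_symm _ (covAlong g Φ Z x (X x)) (covAlong g Φ Z x (Y x))] at h1
  simp only [curvAlong, map_sub, sub_apply]
  linarith

end Weingarten

/-! ### Self-adjoint operators on the tangent plane and Lorentzian algebra of the normal plane. -/

section LinearAlgebra

set_option linter.unusedSectionVars false
set_option maxSynthPendingDepth 3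

variable {V : Type*} [TopologicalSpace V] [ChartedSpace E4 V] [IsManifold (𝓡 4) ∞ V]
variable {S : Type*} [TopologicalSpace S] [ChartedSpace E2 S] [IsManifold (𝓡 2) ∞ S]
variable {g : LorentzMetric V} {Φ : S → V} {x : S}

theorem indForm_add_left (v v' w : E2) :
    indForm g Φ x (v + v') w = indForm g Φ x v w + indForm g Φ x v' w := by simp [indForm]

theorem indForm_add_right (v w w' : E2) :
    indForm g Φ x v (w + w') = indForm g Φ x v w + indForm g Φ x v w' := by simp [indForm]

theorem indForm_sub_right (v w w' : E2) :
    indForm g Φ x v (w - w') = indForm g Φ x v w - indForm g Φ x v w' := by simp [indForm]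

theorem indForm_smul_left (c : ℝ) (v w : E2) :
    indForm g Φ x (c • v) w = c * indForm g Φ x v w := by simp [indForm]

theorem indForm_smul_right (c : ℝ) (v w : E2) :
    indForm g Φ x v (c • w) = c * indForm g Φ x v w := by simp [indForm]

theorem indForm_zero_left (w : E2) : indForm g Φ x 0 w = 0 := by simp [indForm]

theorem indForm_zero_right (w : E2) : indForm g Φ x w 0 = 0 := by simp [indForm]

variable {A B : E2 → E2} {p q : E2}

theorem eq_smul_of_eigenbasis (hΦ : IsSpacelikeImmersion g Φ)
    (hA : ∀ v w, indForm g Φ x (A v) w = indForm g Φ x (A w) v) (hp : p ≠ 0) (hq : q ≠ 0)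
    (hpq : indForm g Φ x p q = 0) {a : ℝ} (hAp : A p = a • p) (hAq : A q = a • q) (v : E2) :
    A v = a • v := by
  have e1 : indForm g Φ x (A v) p = a * indForm g Φ x v p := by
    rw [hA, hAp, indForm_smul_left, indForm_symm]
  have e2 : indForm g Φ x (A v) q = a * indForm g Φ x v q := by
    rw [hA, hAq, indForm_smul_left, indForm_symm]
  rw [indForm_expand hΦ x hp hq hpq (A v), e1, e2]
  conv_rhs => rw [indForm_expand hΦ x hp hq hpq v]
  rw [smul_add, smul_smul, smul_smul, mul_div_assoc, mul_div_assoc]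

theorem apply_eq_smul_of_orthogonal (hΦ : IsSpacelikeImmersion g Φ) (hp : p ≠ 0) (hq : q ≠ 0)
    (hpq : indForm g Φ x p q = 0) (h : indForm g Φ x (A p) q = 0) :
    A p = (indForm g Φ x (A p) p / indForm g Φ x p p) • p := by
  conv_lhs => rw [indForm_expand hΦ x hp hq hpq (A p), h]
  simp

/-- If `A` is diagonal in an orthogonal basis and commutes with `B`, which is not, then `A` is a
multiple of the identity. -/
theorem exists_eq_smul_of_commute (hΦ : IsSpacelikeImmersion g Φ)
    (hA : ∀ v w, indForm g Φ x (A v) w = indForm g Φ x (A w) v)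
    (hB : ∀ v w, indForm g Φ x (B v) w = indForm g Φ x (B w) v)
    (h : ∀ v w, indForm g Φ x (A v) (B w) = indForm g Φ x (A w) (B v)) (hp : p ≠ 0) (hq : q ≠ 0)
    (hpq : indForm g Φ x p q = 0) (hAp : indForm g Φ x (A p) q = 0)
    (hBp : indForm g Φ x (B p) q ≠ 0) : ∃ c : ℝ, ∀ v, A v = c • v := by
  have e1 := apply_eq_smul_of_orthogonal hΦ hp hq hpq hAp
  have e2 := apply_eq_smul_of_orthogonal hΦ hq hp (by rw [indForm_symm, hpq]) ((hA q p).trans hAp)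
  set a := indForm g Φ x (A p) p / indForm g Φ x p p
  set b := indForm g Φ x (A q) q / indForm g Φ x q q
  -- Evaluated at (p, q), the commutation relation says that `a` and `b` agree after multiplication
  -- by the nonzero off-diagonal entry of `B`.
  have hab : a = b := by
    have h1 := h p q
    rw [e1, e2, indForm_smul_left, indForm_smul_left, indForm_symm _ p, hB q p, indForm_symm _ q] at h1
    exact mul_right_cancel₀ hBp h1
  exact ⟨a, eq_smul_of_eigenbasis hΦ hA hp hq hpq e1 (hab ▸ e2)⟩

/-- If every off-diagonal entry vanishes, `B` is diagonal in an orthogonal basis p, q. The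
orthogonal pair p + q and |q|²p - |p|²q then forces the two eigenvalues to agree. -/
theorem exists_offDiagonal (hΦ : IsSpacelikeImmersion g Φ)
    (hB : ∀ v w, indForm g Φ x (B v) w = indForm g Φ x (B w) v)
    (h : ¬ ∃ c : ℝ, ∀ v, B v = c • v) :
    ∃ p q, p ≠ 0 ∧ q ≠ 0 ∧ indForm g Φ x p q = 0 ∧ indForm g Φ x (B p) q ≠ 0 := by
  by_contra! hc
  obtain ⟨X, Y, U, -, hxU, -, -, hXY⟩ := exists_orthogonal_fields hΦ x
  obtain ⟨hpq, hp, hq⟩ := hXY x hxU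
  generalize X x = p at *
  generalize Y x = q at *
  have hpp := indForm_pos hΦ x hp
  have hqq := indForm_pos hΦ x hq
  have hqp : indForm g Φ x q p = 0 := by rw [indForm_symm, hpq]
  have h1 := hc p q hp hq hpq
  have h2 := hc q p hq hp hqp
  have hp' : p + q ≠ 0 := fun h0 ↦ by
    have := congrArg (indForm g Φ x p) h0
    rw [indForm_add_right, hpq, indForm_zero_right, add_zero] at this
    exact hpp.ne' this
  have hq' : indForm g Φ x q q • p - indForm g Φ x p p • q ≠ 0 := fun h0 ↦ by
    have := congrArg (indForm g Φ x p) h0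
    rw [indForm_sub_right, indForm_smul_right, indForm_smul_right, hpq, indForm_zero_right,
      mul_zero, sub_zero] at this
    exact (mul_pos hqq hpp).ne' this
  have h3 := hc _ _ hp' hq' (by
    simp only [indForm_add_left, indForm_sub_right, indForm_smul_right, hpq, hqp]
    ring)
  simp only [indForm_sub_right, indForm_smul_right] at h3
  rw [hB _ p, hB _ q, indForm_add_right, indForm_add_right, h1, h2] at h3
  have e1 := apply_eq_smul_of_orthogonal hΦ hp hq hpq h1
  have e2 := apply_eq_smul_of_orthogonal hΦ hq hp hqp h2
  have hab : indForm g Φ x (B p) p / indForm g Φ x p p = indForm g Φ x (B q) q / indForm g Φ x q q := by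
    rw [div_eq_div_iff hpp.ne' hqq.ne']
    linarith
  exact h ⟨_, eq_smul_of_eigenbasis hΦ hB hp hq hpq e1 (hab ▸ e2)⟩

/-- The signature axiom provides just one timelike vector `t`; this passes to any `u`. The
combination w = g(t,n)u - g(t,u)n is orthogonal to `t`, so 0 < g(w,w) = g(t,n)²g(u,u) +
g(t,u)²g(n,n), where the first term is nonpositive. -/
theorem LorentzMetric.form_pos_of_orthogonal_timelike {P : V} {u n : E4} (hu : g.form P u u < 0)
    (hun : g.form P u n = 0) (hn : n ≠ 0) : 0 < g.form P n n := by
  obtain ⟨t, ht, hpos⟩ := g.signature P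
  have hpos' : ∀ v : E4, g.form P t v = 0 → v ≠ 0 → 0 < g.form P v v := hpos
  have hnu : g.form P n u = 0 := by rw [g.form_symm, hun]
  change E4 at t
  by_cases h0 : g.form P t n = 0
  · exact hpos' n h0 hn
  · set w : E4 := g.form P t n • u - g.form P t u • n with hw
    have htw : g.form P t w = 0 := by
      simp only [hw, map_sub, map_smul, smul_eq_mul]
      ring
    have huw : g.form P u w = g.form P t n * g.form P u u := by
      simp [hw, hun]
    have hw0 : w ≠ 0 := fun h ↦ by
      rw [h, map_zero] at huw
      exact mul_ne_zero h0 hu.ne huw.symm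
    have h1 := hpos' w htw hw0
    have h2 : g.form P w w = g.form P t n ^ 2 * g.form P u u + g.form P t u ^ 2 * g.form P n n := by
      simp only [hw, map_sub, map_smul, smul_eq_mul, sub_apply, smul_apply, hun, hnu]
      ring
    rw [h2] at h1
    have h3 : g.form P t n ^ 2 * g.form P u u ≤ 0 := mul_nonpos_of_nonneg_of_nonpos (sq_nonneg _) hu.le
    by_contra! h4
    have h5 : g.form P t u ^ 2 * g.form P n n ≤ 0 := mul_nonpos_of_nonneg_of_nonpos (sq_nonneg _) h4
    linarith

theorem isNor_of_basis (hΦ : IsSpacelikeImmersion g Φ) (hp : p ≠ 0) (hq : q ≠ 0)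
    (hpq : indForm g Φ x p q = 0) {ξ : E4} (h1 : g.form (Φ x) ξ (dmap Φ x p) = 0)
    (h2 : g.form (Φ x) ξ (dmap Φ x q) = 0) : IsNor g Φ x ξ := fun v ↦ by
  rw [indForm_expand hΦ x hp hq hpq v]
  simp [h1, h2]

/-- The normal planes are Lorentzian. -/
theorem exists_normal_basis (hΦ : IsSpacelikeImmersion g Φ) (x : S) :
    ∃ u n : E4, IsNor g Φ x u ∧ IsNor g Φ x n ∧ g.form (Φ x) u u < 0 ∧ 0 < g.form (Φ x) n n ∧
      g.form (Φ x) u n = 0 := by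
  obtain ⟨t, ht, -⟩ := g.signature (Φ x)
  have ht' : g.form (Φ x) t t < 0 := ht
  change E4 at t
  -- Removing the spacelike tangential part of `t` can only lower its square.
  set u := norPart g Φ x t with hu
  have hun : IsNor g Φ x u := isNor_norPart hΦ x t
  have huu : g.form (Φ x) u u < 0 := by
    have e : t = u + dmap Φ x (tanPart g Φ x t) := by
      rw [hu, norPart_eq]
      abel
    have h1 : g.form (Φ x) t t
        = g.form (Φ x) u u + indForm g Φ x (tanPart g Φ x t) (tanPart g Φ x t) := by
      conv_lhs => rw [e]
      simp only [map_add, add_apply, hun _, g.form_symm _ (dmap _ _ _) u, indForm]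
      ring
    have h2 : 0 ≤ indForm g Φ x (tanPart g Φ x t) (tanPart g Φ x t) := by
      by_cases h0 : tanPart g Φ x t = 0
      · rw [h0, indForm_zero_left]
      · exact (indForm_pos hΦ x h0).le
    linarith
  obtain ⟨X, Y, U, -, hxU, -, -, hXY⟩ := exists_orthogonal_fields hΦ x
  obtain ⟨hpq, hp, hq⟩ := hXY x hxU
  -- Three linear conditions in dimension four leave a nonzero vector orthogonal to `u` and to the
  -- tangent plane.
  let L : E4 →ₗ[ℝ] (Fin 3 → ℝ) := LinearMap.pi ![(g.form (Φ x) u : E4 →ₗ[ℝ] ℝ),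
    (g.form (Φ x) (dmap Φ x (X x)) : E4 →ₗ[ℝ] ℝ), (g.form (Φ x) (dmap Φ x (Y x)) : E4 →ₗ[ℝ] ℝ)]
  obtain ⟨n, hn, hn0⟩ := (Submodule.ne_bot_iff _).1
    (LinearMap.ker_ne_bot_of_finrank_lt (f := L) (by simp))
  have hL (i : Fin 3) : L n i = 0 := congrFun (LinearMap.mem_ker.1 hn) i
  have h0 : g.form (Φ x) u n = 0 := hL 0
  have h1 : g.form (Φ x) (dmap Φ x (X x)) n = 0 := hL 1
  have h2 : g.form (Φ x) (dmap Φ x (Y x)) n = 0 := hL 2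
  exact ⟨u, n, hun, isNor_of_basis hΦ hp hq hpq (by rw [g.form_symm, h1]) (by rw [g.form_symm, h2]),
    huu, LorentzMetric.form_pos_of_orthogonal_timelike huu h0 hn0, h0⟩

/-- The remainder η is orthogonal to `u` and `n`. Were it nonzero, it would be spacelike, and u, n,
η with two orthogonal tangent vectors would be five independent vectors in dimension four. -/
theorem IsNor.expand (hΦ : IsSpacelikeImmersion g Φ) {u n ξ : E4} (hu : IsNor g Φ x u)
    (hn : IsNor g Φ x n) (huu : g.form (Φ x) u u < 0) (hnn : 0 < g.form (Φ x) n n)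
    (hun : g.form (Φ x) u n = 0) (hξ : IsNor g Φ x ξ) :
    ξ = (g.form (Φ x) ξ u / g.form (Φ x) u u) • u + (g.form (Φ x) ξ n / g.form (Φ x) n n) • n := by
  have hnu : g.form (Φ x) n u = 0 := by rw [g.form_symm, hun]
  set η := ξ - ((g.form (Φ x) ξ u / g.form (Φ x) u u) • u
    + (g.form (Φ x) ξ n / g.form (Φ x) n n) • n) with hη
  have hηu : g.form (Φ x) η u = 0 := by
    simp only [hη, map_sub, map_add, map_smul, sub_apply, add_apply, smul_apply, smul_eq_mul, hnu,
      div_mul_cancel₀ _ huu.ne]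
    ring
  have hηn : g.form (Φ x) η n = 0 := by
    simp only [hη, map_sub, map_add, map_smul, sub_apply, add_apply, smul_apply, smul_eq_mul, hun,
      div_mul_cancel₀ _ hnn.ne']
    ring
  have hηnor : IsNor g Φ x η := by
    have := hξ.lin (hu.lin hn (g.form (Φ x) ξ u / g.form (Φ x) u u)
      (g.form (Φ x) ξ n / g.form (Φ x) n n)) 1 (-1)
    rwa [one_smul, neg_one_smul, ← sub_eq_add_neg] at this
  rw [← sub_eq_zero]
  by_contra hne
  have huη : g.form (Φ x) u η = 0 := by rw [g.form_symm, hηu]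
  have hnη : g.form (Φ x) n η = 0 := by rw [g.form_symm, hηn]
  have hηη := LorentzMetric.form_pos_of_orthogonal_timelike huu huη hne
  obtain ⟨X, Y, U, -, hxU, -, -, hXY⟩ := exists_orthogonal_fields hΦ x
  obtain ⟨hpq, hp, hq⟩ := hXY x hxU
  have hqp : indForm g Φ x (Y x) (X x) = 0 := by rw [indForm_symm, hpq]
  have hpp := indForm_pos hΦ x hp
  have hqq := indForm_pos hΦ x hq
  have sw {ζ : E4} (hζ : IsNor g Φ x ζ) (v : E2) : g.form (Φ x) (dmap Φ x v) ζ = 0 := by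
    rw [g.form_symm, hζ]
  rw [indForm] at hpq hqp hpp hqq
  let L : LinearMap.BilinForm ℝ E4 :=
    ContinuousLinearMap.coeLM ℝ ∘ₗ (g.form (Φ x) : E4 →ₗ[ℝ] (E4 →L[ℝ] ℝ))
  have hL (v w : E4) : L v w = g.form (Φ x) v w := rfl
  have hli : LinearIndependent ℝ ![u, n, η, dmap Φ x (X x), dmap Φ x (Y x)] := by
    refine LinearMap.linearIndependent_of_isOrthoᵢ (B := L) ?_ ?_
    · intro i j hij
      change L _ _ = 0
      rw [hL]
      fin_cases i <;> fin_cases j <;>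
        first | exact absurd rfl hij | assumption | exact hu _ | exact hn _ | exact hηnor _ |
          exact sw hu _ | exact sw hn _ | exact sw hηnor _
    · intro i
      change ¬ (L _ _ = 0)
      rw [hL]
      fin_cases i
      exacts [huu.ne, hnn.ne', hηη.ne', hpp.ne', hqq.ne']
  have := hli.fintype_card_le_finrank
  simp at this

end LinearAlgebra

/-! ### Umbilicity as commutation of the Weingarten operators. -/

section Umbilical

set_option linter.unusedSectionVars false
set_option maxSynthPendingDepth 3

variable {V : Type*} [TopologicalSpace V] [ChartedSpace E4 V] [IsManifold (𝓡 4) ∞ V]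
variable {S : Type*} [TopologicalSpace S] [ChartedSpace E2 S] [IsManifold (𝓡 2) ∞ S]
variable {g : LorentzMetric V} {Φ : S → V} {x : S}

theorem umbilicalAt_iff (N : S → E4) :
    UmbilicalAt g Φ N x ↔ ∃ c : ℝ, ∀ v : E2, wein g Φ N x v = c • v := by
  constructor
  · rintro ⟨F, hF⟩
    exact ⟨1 / 2 * F, fun v ↦ (weingarten_eq N x v).symm.trans (hF v)⟩
  · rintro ⟨c, hc⟩
    refine ⟨2 * c, fun v ↦ (weingarten_eq N x v).trans ((hc v).trans ?_)⟩
    have e : 1 / 2 * (2 * c) = c := by ring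
    rw [e]
    rfl

theorem isNormalField_iff (N : S → E4) : IsNormalField g Φ N ↔ NorOn g Φ Set.univ N :=
  ⟨fun h ↦ ⟨h.1, h.2⟩, fun h ↦ ⟨h.1, h.2⟩⟩

theorem isTangentField_iff (X : S → E2) : IsTangentField X ↔ SmoothOn Set.univ X :=
  contMDiffOn_univ.symm

/-- The Weingarten operators at `x` commute. -/
def WeinComm (g : LorentzMetric V) (Φ : S → V) (x : S) : Prop :=
  ∀ N M : S → E4, NorOn g Φ Set.univ N → NorOn g Φ Set.univ M → ∀ v w,
    indForm g Φ x (wein g Φ N x v) (wein g Φ M x w) = indForm g Φ x (wein g Φ N x w) (wein g Φ M x v)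

theorem isNor_norCurv (hΦ : IsSpacelikeImmersion g Φ) (X Y : S → E2) (N : S → E4) :
    IsNor g Φ x (norCurv g Φ X Y N x) := fun v ↦ by
  have h (Z : S → E4) (w : E2) := isNor_norPart hΦ x (covAlong g Φ Z x w) v
  simp only [norCurv, dnor] at h ⊢
  rw [map_sub, map_sub, sub_apply, sub_apply, h, h, h]
  ring

/-- By the Ricci equation, the failure of commutation is the difference of the two sides paired with
normal vectors; as both sides are normal, such pairings determine them. -/
theorem normalCurvatureEqAt_iff [T2Space S] (hΦ : IsSpacelikeImmersion g Φ) :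
    NormalCurvatureEqAt g Φ x ↔ WeinComm g Φ x := by
  constructor
  · intro h N M hN hM v w
    obtain ⟨X, hX, rfl⟩ := exists_tangentField x v
    obtain ⟨Y, hY, rfl⟩ := exists_tangentField x w
    have h1 := h X Y N ((isTangentField_iff X).2 hX) ((isTangentField_iff Y).2 hY)
      ((isNormalField_iff N).2 hN)
    have h2 : norCurv g Φ X Y N x
        = norPart g Φ x (riemannInChart g (Φ x) (dmap Φ x (X x)) (dmap Φ x (Y x)) (N x)) :=
      (normalCurvature_eq X Y N x).symm.trans
        (h1.trans (congrArg (norPart g Φ x) (riemann_eq _ _ _ _)))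
    have h3 := form_norCurv hΦ isOpen_univ (Set.mem_univ x) hN hM hX hY
    rw [h2, form_norPart _ (hM.2 x trivial)] at h3
    linarith
  · intro h X Y N hX hY hN
    change S → E2 at X
    change S → E2 at Y
    change S → E4 at N
    replace hX := (isTangentField_iff X).1 hX
    replace hY := (isTangentField_iff Y).1 hY
    replace hN := (isNormalField_iff N).1 hN
    refine (normalCurvature_eq X Y N x).trans
      (Eq.trans ?_ (congrArg (norPart g Φ x) (riemann_eq _ _ _ _).symm))
    change _ = norPart g Φ x (riemannInChart g (Φ x) (dmap Φ x (X x)) (dmap Φ x (Y x)) (N x))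
    refine IsNor.ext hΦ (isNor_norCurv hΦ X Y N) (isNor_norPart hΦ x _) fun ν hν ↦ ?_
    obtain ⟨M, hM, rfl⟩ := exists_normalField hΦ x hν
    rw [form_norPart _ hν, form_norCurv hΦ isOpen_univ (Set.mem_univ x) hN hM hX hY,
      h N M hN hM (X x) (Y x)]
    ring

/-- It suffices to test commutation on a basis of the normal plane. -/
theorem weinComm_of_basis (hΦ : IsSpacelikeImmersion g Φ) {U : Set S} (hU : IsOpen U) (hx : x ∈ U)
    {u n : S → E4} (hu : NorOn g Φ U u) (hn : NorOn g Φ U n) (huu : g.form (Φ x) (u x) (u x) < 0)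
    (hnn : 0 < g.form (Φ x) (n x) (n x)) (hun : g.form (Φ x) (u x) (n x) = 0)
    (h : ∀ v w, indForm g Φ x (wein g Φ u x v) (wein g Φ n x w)
      = indForm g Φ x (wein g Φ u x w) (wein g Φ n x v)) : WeinComm g Φ x := by
  intro N M hN hM v w
  have eN := wein_lin hΦ isOpen_univ trivial hU hx hU hx hN hu hn
    (IsNor.expand hΦ (hu.2 x hx) (hn.2 x hx) huu hnn hun (hN.2 x trivial))
  have eM := wein_lin hΦ isOpen_univ trivial hU hx hU hx hM hu hn
    (IsNor.expand hΦ (hu.2 x hx) (hn.2 x hx) huu hnn hun (hM.2 x trivial))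
  simp only [eN, eM, indForm_add_left, indForm_add_right, indForm_smul_left, indForm_smul_right]
  rw [indForm_symm x (wein g Φ n x v) (wein g Φ u x w),
    indForm_symm x (wein g Φ n x w) (wein g Φ u x v), h v w,
    indForm_symm x (wein g Φ n x v) (wein g Φ n x w),
    indForm_symm x (wein g Φ u x v) (wein g Φ u x w)]

theorem WeinComm.apply [T2Space S] (hΦ : IsSpacelikeImmersion g Φ) (h : WeinComm g Φ x) {U : Set S}
    (hU : IsOpen U) (hx : x ∈ U) {N M : S → E4} (hN : NorOn g Φ U N) (hM : NorOn g Φ U M)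
    (v w : E2) : indForm g Φ x (wein g Φ N x v) (wein g Φ M x w)
      = indForm g Φ x (wein g Φ N x w) (wein g Φ M x v) := by
  obtain ⟨N', hN', hNx⟩ := exists_normalField hΦ x (hN.2 x hx)
  obtain ⟨M', hM', hMx⟩ := exists_normalField hΦ x (hM.2 x hx)
  have eN := wein_eq_of_eq hΦ isOpen_univ trivial hU hx hN' hN hNx
  have eM := wein_eq_of_eq hΦ isOpen_univ trivial hU hx hM' hM hMx
  rw [← eN, ← eN, ← eM, ← eM]
  exact h N' M' hN' hM' v w

theorem exists_normal_frame_fields [T2Space S] (hΦ : IsSpacelikeImmersion g Φ) (x : S) :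
    ∃ u n : S → E4, NorOn g Φ Set.univ u ∧ NorOn g Φ Set.univ n ∧
      g.form (Φ x) (u x) (u x) < 0 ∧ 0 < g.form (Φ x) (n x) (n x) ∧
      g.form (Φ x) (u x) (n x) = 0 := by
  obtain ⟨u, n, hu, hn, h⟩ := exists_normal_basis hΦ x
  obtain ⟨U, hU, rfl⟩ := exists_normalField hΦ x hu
  obtain ⟨N, hN, rfl⟩ := exists_normalField hΦ x hn
  exact ⟨U, N, hU, hN, h⟩

/-- With N = a u + b n at `x`, umbilicity reads a A_u + b A_n = c·id. Since `a` and `b` are not both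
zero, one operator is a combination of the other and the identity, hence commutes with it. -/
theorem weinComm_of_umbilicalAt [T2Space S] (hΦ : IsSpacelikeImmersion g Φ) {N : S → E4}
    (hN : NorOn g Φ Set.univ N) (hN0 : N x ≠ 0) (h : UmbilicalAt g Φ N x) : WeinComm g Φ x := by
  obtain ⟨c, hc⟩ := (umbilicalAt_iff N).1 h
  obtain ⟨u, n, hu, hn, huu, hnn, hun⟩ := exists_normal_frame_fields hΦ x
  have hx := Set.mem_univ x
  have eN := IsNor.expand hΦ (hu.2 x hx) (hn.2 x hx) huu hnn hun (hN.2 x hx)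
  have eW := wein_lin hΦ isOpen_univ hx isOpen_univ hx isOpen_univ hx hN hu hn eN
  generalize g.form (Φ x) (N x) (u x) / g.form (Φ x) (u x) (u x) = a at *
  generalize g.form (Φ x) (N x) (n x) / g.form (Φ x) (n x) (n x) = b at *
  have key (v z : E2) : a * indForm g Φ x (wein g Φ u x v) z + b * indForm g Φ x (wein g Φ n x v) z
      = c * indForm g Φ x v z := by
    rw [← indForm_smul_left, ← indForm_smul_left, ← indForm_add_left, ← eW, hc, indForm_smul_left]
  refine weinComm_of_basis hΦ isOpen_univ hx hu hn huu hnn hun fun v w ↦ ?_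
  have su := indForm_wein_symm hΦ isOpen_univ hx hu v w
  have sn := indForm_wein_symm hΦ isOpen_univ hx hn v w
  by_cases ha : a = 0
  · have hb : b ≠ 0 := by
      rintro rfl
      rw [ha] at eN
      simp at eN
      exact hN0 eN
    have k1 := key v (wein g Φ u x w)
    have k2 := key w (wein g Φ u x v)
    rw [ha, indForm_symm x v, indForm_symm x (wein g Φ n x v)] at k1
    rw [ha, indForm_symm x w, indForm_symm x (wein g Φ n x w)] at k2
    refine mul_left_cancel₀ hb ?_
    rw [su] at k2
    linarith
  · have k1 := key v (wein g Φ n x w)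
    have k2 := key w (wein g Φ n x v)
    rw [indForm_symm x v] at k1
    rw [indForm_symm x w, indForm_symm x (wein g Φ n x w)] at k2
    refine mul_left_cancel₀ ha ?_
    rw [sn] at k2
    linarith

theorem exists_isNor_notMem_span (hΦ : IsSpacelikeImmersion g Φ) (ν : E4) :
    ∃ ξ : E4, IsNor g Φ x ξ ∧ ∀ c : ℝ, ξ ≠ c • ν := by
  obtain ⟨u, n, hu, hn, huu, hnn, hun⟩ := exists_normal_basis hΦ x
  by_contra! h
  obtain ⟨a, rfl⟩ := h u hu
  obtain ⟨b, rfl⟩ := h n hn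
  simp only [map_smul, smul_apply, smul_eq_mul] at huu hnn hun
  rcases mul_eq_zero.1 hun with h0 | h0
  · simp [h0] at hnn
  · rcases mul_eq_zero.1 h0 with h0 | h0 <;> simp [h0] at huu

/-- Around a point that is not totally umbilical, there is a normal field with respect to which every
nearby point with commuting Weingarten operators is umbilical. -/
theorem exists_umbilical_normalField [T2Space S] (hΦ : IsSpacelikeImmersion g Φ) {N : S → E4}
    (hN : NorOn g Φ Set.univ N) (h : ¬ UmbilicalAt g Φ N x) :
    ∃ N' : S → E4, NorOn g Φ Set.univ N' ∧ N' x ≠ 0 ∧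
      ∀ᶠ y in 𝓝 x, WeinComm g Φ y → UmbilicalAt g Φ N' y := by
  have hO : IsOpen (Set.univ : Set S) := isOpen_univ
  rw [umbilicalAt_iff] at h
  obtain ⟨p, q, hp, hq, hpq, hBpq⟩ :=
    exists_offDiagonal hΦ (indForm_wein_symm hΦ hO (Set.mem_univ x) hN) h
  obtain ⟨X, hX, rfl⟩ := exists_tangentField x p
  obtain ⟨Q, hQ, rfl⟩ := exists_tangentField x q
  -- `Q` need only be orthogonal to `X` at `x`. `W` is orthogonal to `X` everywhere, and is a
  -- positive multiple of `Q` at `x`.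
  set W := orthField g Φ X Q with hWdef
  have hW : SmoothOn Set.univ W := SmoothOn.orthField hΦ hO hX hQ
  obtain ⟨ξ, hξ, hξN⟩ := exists_isNor_notMem_span (x := x) hΦ (N x)
  obtain ⟨M, hM, rfl⟩ := exists_normalField hΦ x hξ
  -- The off-diagonal entry of A_Z in the pair (X, W). It is smooth because it equals g(∇_X Z, dΦ
  -- W).
  let k (Z : S → E4) (y : S) : ℝ := indForm g Φ y (wein g Φ Z y (X y)) (W y)
  have hk {Z : S → E4} (hZ : NorOn g Φ Set.univ Z) :
      ContMDiffOn (𝓡 2) 𝓘(ℝ, ℝ) ∞ (k Z) Set.univ := by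
    refine ((hZ.1.cov (g := g) hO hX).form (g := g) (smoothAlong_dmap hΦ.contMDiff.contMDiffOn hO hW)
      hO).congr fun y _ ↦ ?_
    exact indForm_tanPart hΦ y _ _
  have hkN : k N x ≠ 0 := by
    simp only [k, hWdef, orthField, hpq, zero_smul, sub_zero, indForm_smul_right]
    exact mul_ne_zero (indForm_pos hΦ x hp).ne' hBpq
  -- These coefficients make the off-diagonal entry of A_{N'} equal to k_N k_M - k_M k_N = 0 at
  -- every point, while N' is nonzero at `x` because `M x` is not a multiple of `N x`.
  let N' : S → E4 := fun y ↦ k N y • M y - k M y • N y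
  have eN' (y : S) : N' y = k N y • M y + (-k M y) • N y := by
    simp only [N', neg_smul, sub_eq_add_neg]
  have hN' : NorOn g Φ Set.univ N' :=
    ⟨(SmoothAlong.smul (hk hN) hM.1 hO).sub (SmoothAlong.smul (hk hM) hN.1 hO) hO, fun y hy ↦ by
      rw [eN']
      exact (hM.2 y hy).lin (hN.2 y hy) _ _⟩
  refine ⟨N', hN', fun h0 ↦ hξN (k M x / k N x) ?_, ?_⟩
  · have h1 : k N x • M x = k M x • N x := sub_eq_zero.1 h0
    rw [div_eq_inv_mul, mul_smul, ← h1, smul_smul, inv_mul_cancel₀ hkN, one_smul]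
  · have hc : ContinuousAt (k N) x := (hk hN).continuousOn.continuousAt Filter.univ_mem
    -- Where k_N is nonzero, X and W do not vanish and A_N is not diagonal, so a commuting diagonal
    -- A_{N'} is scalar.
    filter_upwards [hc.eventually_ne hkN] with y hy hcomm
    have hyu := Set.mem_univ y
    have sN := indForm_wein_symm hΦ hO hyu hN
    have hWy : W y ≠ 0 := fun h0 ↦ hy (by simp only [k, h0, indForm_zero_right])
    have hXy : X y ≠ 0 := fun h0 ↦ hy (by simp only [k, h0]; rw [sN, indForm_zero_right])
    rw [umbilicalAt_iff]
    refine exists_eq_smul_of_commute hΦ (indForm_wein_symm hΦ hO hyu hN') sN (hcomm N' N hN' hN) hXy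
      hWy (indForm_orthField X Q y) ?_ hy
    rw [wein_lin hΦ hO hyu hO hyu hO hyu hN' hM hN (eN' y), indForm_add_left, indForm_smul_left,
      indForm_smul_left]
    change k N y * k M y + -k M y * k N y = 0
    ring

theorem umbilicalAlongNormalAt_iff [T2Space S] (hΦ : IsSpacelikeImmersion g Φ) :
    UmbilicalAlongNormalAt g Φ x ↔ WeinComm g Φ x := by
  constructor
  · rintro ⟨N, hN, hN0, h⟩
    exact weinComm_of_umbilicalAt hΦ ((isNormalField_iff N).1 hN) hN0 h
  · intro h
    obtain ⟨u, n, hu, -, huu, -⟩ := exists_normal_frame_fields hΦ x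
    by_cases hum : UmbilicalAt g Φ u x
    · refine ⟨u, (isNormalField_iff u).2 hu, fun h0 ↦ ?_, hum⟩
      have h1 : u x = 0 := h0
      simp [h1] at huu
    · obtain ⟨N, hN, hN0, hev⟩ := exists_umbilical_normalField hΦ hu hum
      exact ⟨N, (isNormalField_iff N).2 hN, hN0, hev.self_of_nhds h⟩

end Umbilical

/-! ### Orthonormal normal frames and the curvature identity. -/

section Frames

set_option linter.unusedSectionVars false
set_option maxSynthPendingDepth 3

variable {V : Type*} [TopologicalSpace V] [ChartedSpace E4 V] [IsManifold (𝓡 4) ∞ V]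
variable {S : Type*} [TopologicalSpace S] [ChartedSpace E2 S] [IsManifold (𝓡 2) ∞ S]
variable {g : LorentzMetric V} {Φ : S → V} {x : S}

theorem LorentzMetric.form_sharp (p : V) (α : E4 →L[ℝ] ℝ) (v : E4) :
    g.form p (g.sharp p α) v = α v := by
  have hi : (g.form p).IsInvertible := isInvertible_of_nondegenerate (g.nondegenerate p)
  exact congrArg (fun L : E4 →L[ℝ] ℝ ↦ L v) (hi.self_apply_inverse α)

theorem form_covAlong_self_of_const {U : Set S} (hU : IsOpen U) (hx : x ∈ U) {Z : S → E4}
    (hZ : SmoothAlong 2 Φ U Z) {c : ℝ} (h : ∀ y ∈ U, g.form (Φ y) (Z y) (Z y) = c) (v : E2) :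
    g.form (Φ x) (Z x) (covAlong g Φ Z x v) = 0 := by
  have h1 := dfun_form (g := g) hZ hZ hU hx v
  have h2 : (fun y ↦ g.form (Φ y) (Z y) (Z y)) =ᶠ[𝓝 x] fun _ ↦ c := by
    filter_upwards [hU.mem_nhds hx] with y hy using h y hy
  rw [dfun_congr h2, dfun_const, g.form_symm _ (covAlong g Φ Z x v)] at h1
  linarith

/-- Polarization of `form_curvAlong_self`, applied to normal fields extending ξ, η and ξ + η. -/
theorem form_riemannInChart_normal_antisymm [T2Space S] (hΦ : IsSpacelikeImmersion g Φ) (v w : E2)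
    {ξ η : E4} (hξ : IsNor g Φ x ξ) (hη : IsNor g Φ x η) :
    g.form (Φ x) (riemannInChart g (Φ x) (dmap Φ x v) (dmap Φ x w) ξ) η
      = - g.form (Φ x) (riemannInChart g (Φ x) (dmap Φ x v) (dmap Φ x w) η) ξ := by
  obtain ⟨X, hX, rfl⟩ := exists_tangentField x v
  obtain ⟨Y, hY, rfl⟩ := exists_tangentField x w
  have self {ν : E4} (hν : IsNor g Φ x ν) :
      g.form (Φ x) (riemannInChart g (Φ x) (dmap Φ x (X x)) (dmap Φ x (Y x)) ν) ν = 0 := by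
    obtain ⟨N, hN, rfl⟩ := exists_normalField hΦ x hν
    have h1 := form_curvAlong_self (g := g) isOpen_univ (Set.mem_univ x) hN.1 hX hY
    rwa [curvAlong_eq hN.1 isOpen_univ hX hY (Set.mem_univ x)] at h1
  have h1 := self hξ
  have h2 := self hη
  have h3 := self (hξ.lin hη 1 1)
  have e : riemannInChart g (Φ x) (dmap Φ x (X x)) (dmap Φ x (Y x)) ((1 : ℝ) • ξ + (1 : ℝ) • η)
      = riemannInChart g (Φ x) (dmap Φ x (X x)) (dmap Φ x (Y x)) ξ
        + riemannInChart g (Φ x) (dmap Φ x (X x)) (dmap Φ x (Y x)) η := by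
    simp only [riemannInChart, map_add, one_smul]
    abel
  rw [e] at h3
  simp only [map_add, one_smul, add_apply] at h3
  linarith

namespace NormalFrame

variable (F : NormalFrame g Φ)

/-- The timelike field of the frame, on components. -/
def uVec : S → E4 := F.u

/-- The spacelike field of the frame, on components. -/
def nVec : S → E4 := F.n

/-- The Hodge dual on components. -/
noncomputable def hodge (x : S) (N : E4) : E4 := F.star x N

theorem norOn_u : NorOn g Φ F.dom F.uVec := ⟨F.normal_u.1, F.normal_u.2⟩

theorem norOn_n : NorOn g Φ F.dom F.nVec := ⟨F.normal_n.1, F.normal_n.2⟩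

theorem form_uu (hx : x ∈ F.dom) : g.form (Φ x) (F.uVec x) (F.uVec x) = -1 := F.uu x hx

theorem form_nn (hx : x ∈ F.dom) : g.form (Φ x) (F.nVec x) (F.nVec x) = 1 := F.nn x hx

theorem form_un (hx : x ∈ F.dom) : g.form (Φ x) (F.uVec x) (F.nVec x) = 0 := F.un x hx

theorem expand (hΦ : IsSpacelikeImmersion g Φ) (hx : x ∈ F.dom) {ξ : E4} (hξ : IsNor g Φ x ξ) :
    ξ = (-g.form (Φ x) (F.uVec x) ξ) • F.uVec x + (g.form (Φ x) (F.nVec x) ξ) • F.nVec x := by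
  have h := IsNor.expand hΦ (F.norOn_u.2 x hx) (F.norOn_n.2 x hx) (by rw [F.form_uu hx]; norm_num)
    (by rw [F.form_nn hx]; norm_num) (F.form_un hx) hξ
  rwa [F.form_uu hx, F.form_nn hx, div_one, div_neg, div_one, g.form_symm _ ξ, g.form_symm _ ξ] at h

theorem s_eq (y : S) (v : E2) : F.s y v = g.form (Φ y) (dnor g Φ F.uVec y v) (F.nVec y) :=
  congrArg (fun ξ : E4 ↦ g.form (Φ y) ξ (F.nVec y)) (normalConnection_eq F.uVec y v)

/-- The term g(D_Y u, ∇_v n) drops out: u has constant square, so D_Y u is a multiple of n, while n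
has constant square, so ∇_v n is orthogonal to n. -/
theorem dfun_s (hΦ : IsSpacelikeImmersion g Φ) (hx : x ∈ F.dom) {Y : S → E2}
    (hY : SmoothOn F.dom Y) (v : E2) :
    dfun 2 (fun y ↦ F.s y (Y y)) x v
      = g.form (Φ x) (dnor g Φ (fun y ↦ dnor g Φ F.uVec y (Y y)) x v) (F.nVec x) := by
  have hD : SmoothAlong 2 Φ F.dom (fun y ↦ dnor g Φ F.uVec y (Y y)) :=
    F.norOn_u.1.dnor hΦ F.isOpen hY
  have hnor := isNor_norPart hΦ x (covAlong g Φ F.uVec x (Y x))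
  have e1 : (fun y ↦ F.s y (Y y)) = fun y ↦ g.form (Φ y) (dnor g Φ F.uVec y (Y y)) (F.nVec y) :=
    funext fun y ↦ F.s_eq y (Y y)
  have e2 : g.form (Φ x) (F.uVec x) (dnor g Φ F.uVec x (Y x)) = 0 := by
    rw [g.form_symm, dnor, form_norPart _ (F.norOn_u.2 x hx), g.form_symm]
    exact form_covAlong_self_of_const F.isOpen hx F.norOn_u.1 (fun y hy ↦ F.form_uu hy) _
  have e3 := F.expand hΦ hx hnor
  have e4 := form_covAlong_self_of_const F.isOpen hx F.norOn_n.1 (fun y hy ↦ F.form_nn hy) v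
  have e5 : g.form (Φ x) (dnor g Φ F.uVec x (Y x)) (covAlong g Φ F.nVec x v) = 0 := by
    rw [dnor] at e2 ⊢
    rw [e3, e2, map_add, map_smul, map_smul, add_apply, smul_apply, smul_apply, e4]
    simp
  rw [e1, dfun_form hD F.norOn_n.1 F.isOpen hx, e5, add_zero]
  exact (form_norPart _ (F.norOn_n.2 x hx)).symm

theorem ds_eq (hΦ : IsSpacelikeImmersion g Φ) (hx : x ∈ F.dom) {X Y : S → E2}
    (hX : SmoothOn F.dom X) (hY : SmoothOn F.dom Y) :
    F.ds X Y x = g.form (Φ x) (norCurv g Φ X Y F.uVec x) (F.nVec x) := by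
  have h : F.ds X Y x = dfun 2 (fun y ↦ F.s y (Y y)) x (X x) - dfun 2 (fun y ↦ F.s y (X y)) x (Y x)
      - F.s x (bracket 2 X Y x) := rfl
  rw [h, F.dfun_s hΦ hx hY, F.dfun_s hΦ hx hX, F.s_eq, norCurv, map_sub, map_sub, sub_apply,
    sub_apply]

theorem form_star (N M : E4) : g.form (Φ x) (F.hodge x N) M
    = g.form (Φ x) (F.nVec x) N * g.form (Φ x) (F.uVec x) M
      - g.form (Φ x) (F.uVec x) N * g.form (Φ x) (F.nVec x) M :=
  LorentzMetric.form_sharp _ _ _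

/-- A skew form on a plane is fixed by its value on (u, n), and (N, M) ↦ g(⋆N, M) is the skew form
with value 1 there. -/
theorem form_riemannInChart [T2Space S] (hΦ : IsSpacelikeImmersion g Φ) (hx : x ∈ F.dom) (v w : E2)
    {N M : E4} (hN : IsNor g Φ x N) (hM : IsNor g Φ x M) :
    g.form (Φ x) M (riemannInChart g (Φ x) (dmap Φ x v) (dmap Φ x w) N)
      = g.form (Φ x) (riemannInChart g (Φ x) (dmap Φ x v) (dmap Φ x w) (F.uVec x)) (F.nVec x)
        * g.form (Φ x) (F.hodge x N) M := by
  have hu := F.norOn_u.2 x hx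
  have hn := F.norOn_n.2 x hx
  have huu := form_riemannInChart_normal_antisymm hΦ v w hu hu
  have hnn := form_riemannInChart_normal_antisymm hΦ v w hn hn
  have hun := form_riemannInChart_normal_antisymm hΦ v w hn hu
  have e (a b : ℝ) : riemannInChart g (Φ x) (dmap Φ x v) (dmap Φ x w)
        (a • F.uVec x + b • F.nVec x)
      = a • riemannInChart g (Φ x) (dmap Φ x v) (dmap Φ x w) (F.uVec x)
        + b • riemannInChart g (Φ x) (dmap Φ x v) (dmap Φ x w) (F.nVec x) := by
    simp only [riemannInChart, map_add, map_smul, smul_add, smul_sub]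
    abel
  rw [F.form_star, g.form_symm]
  generalize hR : riemannInChart g (Φ x) (dmap Φ x v) (dmap Φ x w) = R at *
  have eN := congrArg R (F.expand hΦ hx hN)
  rw [e] at eN
  conv_lhs => rw [eN, F.expand hΦ hx hM]
  simp only [map_add, map_smul, add_apply, smul_apply, smul_eq_mul]
  have huu' : g.form (Φ x) (R (F.uVec x)) (F.uVec x) = 0 := by linarith
  have hnn' : g.form (Φ x) (R (F.nVec x)) (F.nVec x) = 0 := by linarith
  rw [huu', hnn', hun]
  ring

/-- Both sides are multiples of g(⋆N, M), so the identity only compares g(R(X,Y)u, n) with ds(X,Y).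
By the Ricci equation these differ by the commutator term of A_u and A_n. -/
theorem curvatureEqAt_iff [T2Space S] (hΦ : IsSpacelikeImmersion g Φ) (hx : x ∈ F.dom) :
    F.CurvatureEqAt x ↔ WeinComm g Φ x := by
  have hds {X Y : S → E2} (hX : SmoothOn Set.univ X) (hY : SmoothOn Set.univ Y) :
      F.ds X Y x = g.form (Φ x) (riemannInChart g (Φ x) (dmap Φ x (X x)) (dmap Φ x (Y x)) (F.uVec x))
          (F.nVec x) + indForm g Φ x (wein g Φ F.uVec x (Y x)) (wein g Φ F.nVec x (X x))
        - indForm g Φ x (wein g Φ F.uVec x (X x)) (wein g Φ F.nVec x (Y x)) := by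
    have hX' := hX.mono (Set.subset_univ F.dom)
    have hY' := hY.mono (Set.subset_univ F.dom)
    rw [F.ds_eq hΦ hx hX' hY']
    exact form_norCurv hΦ F.isOpen hx F.norOn_u F.norOn_n hX' hY'
  constructor
  · intro h
    refine weinComm_of_basis hΦ F.isOpen hx F.norOn_u F.norOn_n (by rw [F.form_uu hx]; norm_num)
      (by rw [F.form_nn hx]; norm_num) (F.form_un hx) fun v w ↦ ?_
    obtain ⟨X, hX, rfl⟩ := exists_tangentField x v
    obtain ⟨Y, hY, rfl⟩ := exists_tangentField x w
    obtain ⟨N, hN, hNx⟩ := exists_normalField hΦ x (F.norOn_u.2 x hx)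
    obtain ⟨M, hM, hMx⟩ := exists_normalField hΦ x (F.norOn_n.2 x hx)
    have h1 := h X Y M N ((isTangentField_iff X).2 hX) ((isTangentField_iff Y).2 hY)
      ((isNormalField_iff M).2 hM) ((isNormalField_iff N).2 hN)
    have h2 : g.form (Φ x) (M x) (riemannInChart g (Φ x) (dmap Φ x (X x)) (dmap Φ x (Y x)) (N x))
        = F.ds X Y x * g.form (Φ x) (F.hodge x (N x)) (M x) :=
      (congrArg (fun ξ : E4 ↦ g.form (Φ x) (M x) ξ) (riemann_eq _ _ _ _).symm).trans h1
    -- Tested on N = u and M = n at `x`, where g(⋆u, n) = 1.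
    rw [F.form_star, hNx, hMx, F.form_uu hx, F.form_nn hx, F.form_un hx, g.form_symm _ (F.nVec x),
      hds hX hY] at h2
    linarith
  · intro h X Y M N hX hY hM hN
    change S → E2 at X
    change S → E2 at Y
    change S → E4 at N
    change S → E4 at M
    replace hX := (isTangentField_iff X).1 hX
    replace hY := (isTangentField_iff Y).1 hY
    replace hN := (isNormalField_iff N).1 hN
    replace hM := (isNormalField_iff M).1 hM
    refine (congrArg (fun ξ : E4 ↦ g.form (Φ x) (M x) ξ) (riemann_eq _ _ _ _)).trans ?_
    refine (F.form_riemannInChart hΦ hx (X x) (Y x) (hN.2 x trivial) (hM.2 x trivial)).trans ?_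
    have h1 := hds hX hY
    rw [h.apply hΦ F.isOpen hx F.norOn_u F.norOn_n (Y x) (X x)] at h1
    refine congrArg (· * g.form (Φ x) (F.hodge x (N x)) (M x)) ?_
    linarith

end NormalFrame

theorem contMDiffOn_inv_sqrt {U : Set S} (hU : IsOpen U) {k : S → ℝ}
    (hk : ContMDiffOn (𝓡 2) 𝓘(ℝ, ℝ) ∞ k U) (hpos : ∀ y ∈ U, 0 < k y) :
    ContMDiffOn (𝓡 2) 𝓘(ℝ, ℝ) ∞ (fun y ↦ (√(k y))⁻¹) U := fun y hy ↦ by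
  have h : ContDiffAt ℝ ∞ (fun t : ℝ ↦ (√t)⁻¹) (k y) :=
    (Real.contDiffAt_sqrt (hpos y hy).ne').inv (Real.sqrt_pos.2 (hpos y hy)).ne'
  exact (h.comp_contMDiffAt (hk.contMDiffAt (hU.mem_nhds hy))).contMDiffWithinAt

theorem NorOn.smul {U : Set S} (hU : IsOpen U) {a : S → ℝ}
    (ha : ContMDiffOn (𝓡 2) 𝓘(ℝ, ℝ) ∞ a U) {N : S → E4} (hN : NorOn g Φ U N) :
    NorOn g Φ U (fun y ↦ a y • N y) :=
  ⟨SmoothAlong.smul ha hN.1 hU, fun y hy v ↦ by simp [hN.2 y hy v]⟩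

theorem exists_normalFrame [T2Space S] (hΦ : IsSpacelikeImmersion g Φ) (x : S) :
    ∃ F : NormalFrame g Φ, x ∈ F.dom := by
  obtain ⟨u, n, hu, hn, huu, hnn, hun⟩ := exists_normal_frame_fields hΦ x
  have hO : IsOpen (Set.univ : Set S) := isOpen_univ
  -- Gram-Schmidt without division: `m` is orthogonal to `u` at every point. At `x` its square is
  -- g(u,u)²g(n,n) > 0, so normalization is possible on an open set around `x`.
  set m : S → E4 := fun y ↦ g.form (Φ y) (u y) (u y) • n y - g.form (Φ y) (u y) (n y) • u y with hm
  have hmnor : NorOn g Φ Set.univ m := by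
    have h1 := NorOn.smul hO (hu.1.form (g := g) hu.1 hO) hn
    have h2 := NorOn.smul hO (hu.1.form (g := g) hn.1 hO) hu
    exact ⟨h1.1.sub h2.1 hO, fun y hy v ↦ by
      have e1 := h1.2 y hy v
      have e2 := h2.2 y hy v
      simp only [hm, map_sub, sub_apply, e1, e2, sub_zero]⟩
  have hum (y : S) : g.form (Φ y) (u y) (m y) = 0 := by
    simp only [hm, map_sub, map_smul, smul_eq_mul]
    ring
  set α : S → ℝ := fun y ↦ -g.form (Φ y) (u y) (u y) with hα
  set β : S → ℝ := fun y ↦ g.form (Φ y) (m y) (m y) with hβ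
  have sα : ContMDiffOn (𝓡 2) 𝓘(ℝ, ℝ) ∞ α Set.univ := (hu.1.form hu.1 hO).neg
  have sβ : ContMDiffOn (𝓡 2) 𝓘(ℝ, ℝ) ∞ β Set.univ := hmnor.1.form hmnor.1 hO
  set D : Set S := α ⁻¹' Set.Ioi 0 ∩ β ⁻¹' Set.Ioi 0 with hD
  have hDo : IsOpen D := ((continuousOn_univ.1 sα.continuousOn).isOpen_preimage _ isOpen_Ioi).inter
    ((continuousOn_univ.1 sβ.continuousOn).isOpen_preimage _ isOpen_Ioi)
  have hDα : ∀ y ∈ D, 0 < α y := fun y hy ↦ hy.1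
  have hDβ : ∀ y ∈ D, 0 < β y := fun y hy ↦ hy.2
  have cα := contMDiffOn_inv_sqrt hDo (sα.mono (Set.subset_univ D)) hDα
  have cβ := contMDiffOn_inv_sqrt hDo (sβ.mono (Set.subset_univ D)) hDβ
  have nu := NorOn.smul hDo cα (hu.mono (Set.subset_univ D))
  have nn := NorOn.smul hDo cβ (hmnor.mono (Set.subset_univ D))
  have sq {t : ℝ} (ht : 0 < t) : (√t)⁻¹ * ((√t)⁻¹ * t) = 1 := by
    rw [← mul_assoc, ← mul_inv, Real.mul_self_sqrt ht.le, inv_mul_cancel₀ ht.ne']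
  have xβ : 0 < β x := by
    have e : m x = g.form (Φ x) (u x) (u x) • n x := by simp [hm, hun]
    simp only [hβ, e, map_smul, smul_apply, smul_eq_mul]
    exact mul_pos_of_neg_of_neg huu (mul_neg_of_neg_of_pos huu hnn)
  refine ⟨⟨D, hDo, fun y ↦ ((√(α y))⁻¹ • u y : E4), fun y ↦ ((√(β y))⁻¹ • m y : E4), ⟨nu.1, nu.2⟩,
    ⟨nn.1, nn.2⟩, fun y hy ↦ ?_, fun y hy ↦ ?_, fun y hy ↦ ?_⟩, neg_pos.2 huu, xβ⟩
  · change g.form (Φ y) ((√(α y))⁻¹ • u y) ((√(α y))⁻¹ • u y) = -1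
    have h := sq (hDα y hy)
    simp only [map_smul, smul_apply, smul_eq_mul]
    have e : g.form (Φ y) (u y) (u y) = -α y := by simp [hα]
    rw [e]
    linarith
  · change g.form (Φ y) ((√(β y))⁻¹ • m y) ((√(β y))⁻¹ • m y) = 1
    simp only [map_smul, smul_apply, smul_eq_mul]
    exact sq (hDβ y hy)
  · change g.form (Φ y) ((√(α y))⁻¹ • u y) ((√(β y))⁻¹ • m y) = 0
    simp [hum]

theorem NorOn.eventually_ne {N : S → E4} (hN : NorOn g Φ Set.univ N) (h0 : N x ≠ 0) :
    ∀ᶠ y in 𝓝 x, N y ≠ 0 := by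
  have hc : ContinuousAt (chartSec (Φ x) Φ N) x := (hN.1.contMDiffAt_chartSec isOpen_univ
    (Set.mem_univ x) (mem_extChartAt_source (I := 𝓡 4) (Φ x))).continuousAt
  have h1 : chartSec (Φ x) Φ N x ≠ 0 := by rwa [chartSec_self]
  filter_upwards [hc.eventually_ne h1] with y hy h
  exact hy (by rw [chartSec, h, map_zero])

end Frames

/-! ### The main theorem. -/

theorem theorem2 {V : Type*} [TopologicalSpace V] [ChartedSpace E4 V] [IsManifold (𝓡 4) ∞ V]
    {S : Type*} [TopologicalSpace S] [T2Space S] [ChartedSpace E2 S] [IsManifold (𝓡 2) ∞ S]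
    (g : LorentzMetric V) (Φ : S → V) (hΦ : IsSpacelikeImmersion g Φ) :
    -- at every point of the surface
    (∀ x : S, List.TFAE [
      UmbilicalAlongNormalAt g Φ x,
      NormalCurvatureEqAt g Φ x,
      ∀ F : NormalFrame g Φ, x ∈ F.dom → F.CurvatureEqAt x,
      ∃ F : NormalFrame g Φ, x ∈ F.dom ∧ F.CurvatureEqAt x]) ∧
    -- on the whole surface
    List.TFAE [
      ∀ x : S, UmbilicalAlongNormalAt g Φ x,
      ∀ x : S, NormalCurvatureEqAt g Φ x,
      ∀ F : NormalFrame g Φ, ∀ x ∈ F.dom, F.CurvatureEqAt x] ∧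
    -- smoothness of the umbilical direction where the surface is not totally umbilical
    (∀ x : S, ¬ TotallyUmbilicalAt g Φ x →
      ((∀ᶠ y in 𝓝 x, NormalCurvatureEqAt g Φ y) ↔
        ∃ N : ∀ y : S, TangentSpace (𝓡 4) (Φ y), IsNormalField g Φ N ∧ N x ≠ 0 ∧
          ∀ᶠ y in 𝓝 x, UmbilicalAt g Φ N y)) := by
  have hframe (x : S) : (∀ F : NormalFrame g Φ, x ∈ F.dom → F.CurvatureEqAt x) ↔ WeinComm g Φ x := by
    refine ⟨fun h ↦ ?_, fun h F hx ↦ (F.curvatureEqAt_iff hΦ hx).2 h⟩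
    -- A frame exists around every point, so the universal condition is not vacuous.
    obtain ⟨F, hF⟩ := exists_normalFrame hΦ x
    exact (F.curvatureEqAt_iff hΦ hF).1 (h F hF)
  refine ⟨fun x ↦ ?_, ?_, fun x hx ↦ ⟨fun h ↦ ?_, ?_⟩⟩
  · tfae_have 1 ↔ 2 := (umbilicalAlongNormalAt_iff hΦ).trans (normalCurvatureEqAt_iff hΦ).symm
    tfae_have 2 ↔ 3 := (normalCurvatureEqAt_iff hΦ).trans (hframe x).symm
    tfae_have 3 → 4 := fun h ↦ by
      obtain ⟨F, hF⟩ := exists_normalFrame hΦ x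
      exact ⟨F, hF, h F hF⟩
    tfae_have 4 → 2 := fun ⟨F, hF, h⟩ ↦
      (normalCurvatureEqAt_iff hΦ).2 ((F.curvatureEqAt_iff hΦ hF).1 h)
    tfae_finish
  · tfae_have 1 ↔ 2 := forall_congr' fun x ↦
      (umbilicalAlongNormalAt_iff hΦ).trans (normalCurvatureEqAt_iff hΦ).symm
    tfae_have 2 → 3 := fun h F x hx ↦
      (F.curvatureEqAt_iff hΦ hx).2 ((normalCurvatureEqAt_iff hΦ).1 (h x))
    tfae_have 3 → 2 := fun h x ↦
      (normalCurvatureEqAt_iff hΦ).2 ((hframe x).1 fun F hx ↦ h F x hx)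
    tfae_finish
  -- A normal field that is not umbilical at `x` is the seed of the construction of the smooth
  -- umbilical direction.
  · simp only [TotallyUmbilicalAt, not_forall] at hx
    obtain ⟨N, hN, hNx⟩ := hx
    obtain ⟨N', hN', hN'x, hev⟩ :=
      exists_umbilical_normalField hΦ ((isNormalField_iff N).1 hN) hNx
    refine ⟨N', (isNormalField_iff N').2 hN', hN'x, ?_⟩
    filter_upwards [h, hev] with y h1 h2 using h2 ((normalCurvatureEqAt_iff hΦ).1 h1)
  · rintro ⟨N, hN, hNx, hev⟩
    have hN' := (isNormalField_iff N).1 hN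
    -- The pointwise criterion needs N nonzero at each nearby point, which holds by continuity.
    filter_upwards [hev, hN'.eventually_ne hNx] with y h1 h2
    exact (normalCurvatureEqAt_iff hΦ).2 (weinComm_of_umbilicalAt hΦ hN' h2 h1)
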